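/- Theorem 8.1. For $\lambda,\kappa\in\mathbb R$ consider the system $$u_{xt}+uu_{xx}=\lambda u_x^2-\lambda b_x^2+\kappa bb_{xx}+I(t),\qquad b_t+ub_x=\kappa bu_x,\qquad u_t+uu_x=-p_x+bb_x,$$ $$I(t)=(\lambda+\kappa)\int_0^1 b_x^2\,dx-(\lambda+1)\int_0^1u_x^2\,dx,$$ with initial data $(u,b)(x,0)=(u_0(x),b_0(x))$, in one of two settings: (D) the Dirichlet setting, $x\in[0,1]$, $u(0,t)=u(1,t)=b(0,t)=b(1,t)=0$; or (P) the periodic setting, in which $u$ and $b$ (but not necessarily $p$) are $1$-periodic in $x\in\mathbb R$. Write $X=[0,1]$ in (D) and $X=\mathbb R$ in (P). A smooth solution on $[0,T)$, $0<T\le\infty$, is a triple $(u,b,p)$ of functions that are $C^\infty$ on $X\times[0,T)$, up to the boundary, and satisfy the system, the initial condition, and the boundary or periodicity condition. Let $\lambda=\kappa=0$, and let $u_0,b_0\in C^\infty(X)$ satisfy $u_0(0)=u_0(1)=b_0(0)=b_0(1)=0$ in (D), and be $1$-periodic in (P). Then: 1. Solutions exist globally: there is a smooth solution $(u,b,p)$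 on $[0,\infty)$, with $p(0,t)=p(1,t)$ for all $t\ge0$ in (P). For every $0<T\le\infty$, every smooth solution on $[0,T)$ with the same data (and, in (P), with pressure satisfying $p(0,t)=p(1,t)$ for $0\le t<T$) has the same $u$ and $b$ on $X\times[0,T)$. 2. For every $0<T\le\infty$ and every smooth solution $(u,b,p)$ on $[0,T)$ (with no condition on $p$ at $x=0,1$), there are trajectories $\gamma(\alpha,t)\in X$, $\alpha\in X$, $0\le t<T$, with $\gamma_t(\alpha,t)=u(\gamma(\alpha,t),t)$ and $\gamma(\alpha,0)=\alpha$, and any such trajectories satisfy, for all $\alpha\in X$ and $0\le t<T$, $$\gamma_\alpha(\alpha,t)=e^{\int_0^tu_x(\gamma(\alpha,s),s)\,ds}=e^{tu_0'(\alpha)}\left(\int_0^1e^{tu_0'(a)}\,da\right)^{-1},\qquad b(\gamma(\alpha,t),t)=b_0(\alpha),$$ $$0\le u_0'(\alpha)-u_x(\gamma(\alpha,t),t)\le\int_0^1u_0'(a)e^{tu_0'(a)}\,da.$$ -/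

import Mathlib

open Set
open scoped ContDiff

/-- The two kinds of boundary condition on the unit interval. -/
inductive BdryKind
  | dirichlet
  | periodic

/-- The spatial domain: the closed interval `[0,1]` for the Dirichlet condition; for the periodic
condition functions are regarded as `1`-periodic functions on the line (smoothness is smoothness on
the circle, and trajectories may leave `[0,1]`). -/
def BdryKind.space : BdryKind → Set ℝ
  | .dirichlet => Icc 0 1
  | .periodic => univ

/-- The boundary condition for a spatial profile `f`: `f(0) = f(1) = 0`, respectively
`f(x + 1) = f(x)` for all `x` (so that `f` and all its derivatives agree at `0` and `1`). -/
def BdryKind.Holds : BdryKind → (ℝ → ℝ) → Prop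
  | .dirichlet, f => f 0 = 0 ∧ f 1 = 0
  | .periodic, f => ∀ x, f (x + 1) = f x

/-- The time interval `[0,T)`, where `T = ⊤` gives `[0,∞)`. -/
def timeIvl (T : EReal) : Set ℝ := {t : ℝ | 0 ≤ t ∧ (t : EReal) < T}

/-- The partial derivative in `x` on the spatial domain (one-sided at the end points of `[0,1]`). -/
noncomputable def partialX (bc : BdryKind) (f : ℝ → ℝ → ℝ) (x t : ℝ) : ℝ :=
  derivWithin (fun y => f y t) bc.space x

/-- The partial derivative in `t` on `[0,T)` (one-sided at `t = 0`). -/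
noncomputable def partialT (T : EReal) (f : ℝ → ℝ → ℝ) (x t : ℝ) : ℝ :=
  derivWithin (fun s => f x s) (timeIvl T) t

/-- The nonlocal term
`I(t) = (lam + kap) ‖b_x(·,t)‖² - (lam + 1) ‖u_x(·,t)‖²`, with norms in `L²([0,1])`. -/
noncomputable def nonlocalTerm (bc : BdryKind) (lam kap : ℝ) (u b : ℝ → ℝ → ℝ) (t : ℝ) : ℝ :=
  (lam + kap) * (∫ x in (0 : ℝ)..1, (partialX bc b x t) ^ 2)
    - (lam + 1) * (∫ x in (0 : ℝ)..1, (partialX bc u x t) ^ 2)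

/-- `f(x,t)` is smooth (up to the boundary) on the spatial domain times `[0,T)`. -/
def SmoothOn (bc : BdryKind) (T : EReal) (f : ℝ → ℝ → ℝ) : Prop :=
  ContDiffOn ℝ ∞ (fun q : ℝ × ℝ => f q.1 q.2) (bc.space ×ˢ timeIvl T)

/-- `(u, b, p)` is a smooth solution on `[0,T)` of the generalized system with parameters
`lam`, `kap`, the given boundary condition, and initial data `(u₀, b₀)`. -/
structure IsSolution (bc : BdryKind) (lam kap : ℝ) (T : EReal) (u₀ b₀ : ℝ → ℝ)
    (u b p : ℝ → ℝ → ℝ) : Prop where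
  smooth_u : SmoothOn bc T u
  smooth_b : SmoothOn bc T b
  smooth_p : SmoothOn bc T p
  bdry_u : ∀ t ∈ timeIvl T, bc.Holds (fun x => u x t)
  bdry_b : ∀ t ∈ timeIvl T, bc.Holds (fun x => b x t)
  init_u : ∀ x ∈ bc.space, u x 0 = u₀ x
  init_b : ∀ x ∈ bc.space, b x 0 = b₀ x
  eq_ux : ∀ x ∈ bc.space, ∀ t ∈ timeIvl T,
    partialT T (partialX bc u) x t + u x t * partialX bc (partialX bc u) x t
      = lam * (partialX bc u x t) ^ 2 - lam * (partialX bc b x t) ^ 2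
        + kap * b x t * partialX bc (partialX bc b) x t + nonlocalTerm bc lam kap u b t
  eq_b : ∀ x ∈ bc.space, ∀ t ∈ timeIvl T,
    partialT T b x t + u x t * partialX bc b x t = kap * b x t * partialX bc u x t
  eq_u : ∀ x ∈ bc.space, ∀ t ∈ timeIvl T,
    partialT T u x t + u x t * partialX bc u x t
      = - partialX bc p x t + b x t * partialX bc b x t

/-- `γ` is the family of Lagrangian trajectories of `u`:
`γ_t(α,t) = u(γ(α,t),t)` and `γ(α,0) = α`. -/
structure IsFlow (bc : BdryKind) (T : EReal) (u : ℝ → ℝ → ℝ) (γ : ℝ → ℝ → ℝ) : Prop where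
  mem : ∀ α ∈ bc.space, ∀ t ∈ timeIvl T, γ α t ∈ bc.space
  init : ∀ α ∈ bc.space, γ α 0 = α
  ode : ∀ α ∈ bc.space, ∀ t ∈ timeIvl T,
    HasDerivWithinAt (γ α) (u (γ α t) t) (timeIvl T) t

open MeasureTheory Filter Topology

/-! ### The space and time domains -/

/-! For λ = κ = 0 the right side of the equation for `u_x` is a function of time alone, namely
-∫u_x², and its left side is the derivative of `u_x` along trajectories. Hence u_x(γ(α,t),t) =
u₀'(α) + F(t), with F ≤ 0 independent of the label α (`IsSolution.exists_gradient_drift`). The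
Jacobian of the flow is the exponential of the time integral of `u_x` along the trajectory, that is
e^{tu₀'(α)} e^{∫F}.

The flow fixes the walls or commutes with unit translation, so the Jacobian has integral 1 over the
labels in [0,1]. With M(t) = ∫e^{tu₀'} this says M e^{∫F} = 1, which is the Jacobian formula.
Differentiating gives MF = -M'. Since u₀' has mean zero, M ≥ 1, so 0 ≤ -F ≤ M'
(`IsSolution.flow_formulas`). The field `b` is merely transported.

Uniqueness: the Jacobian depends on u₀ only, so the flows of two solutions differ by a translation
depending on time. A wall excludes it in the Dirichlet setting. In the periodic setting, equal end
pressures make the mean of `u` a conserved quantity, and pulling the mean back to labels shows that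
the velocity of the translation vanishes (`IsSolution.flow_eq`).

Existence reads the formulas backwards. Integrating the explicit Jacobian in the label gives a map G
up to a translation c(t). The translation is 0 in the Dirichlet setting; in the periodic setting c''
is chosen to make the mean acceleration vanish, which amounts to p(0,t) = p(1,t)
(`exists_isFlowMap`). Inverting G smoothly (`JointSmooth.inverse`) gives u = G_t ∘ G⁻¹ and b = b₀ ∘
G⁻¹, and the momentum equation defines `p`. The equation for `u_x` reduces to an ordinary
differential equation for F (`hasDerivAt_gradientDrift`). Everything is defined for all real times.
-/

theorem BdryKind.convex_space (bc : BdryKind) : Convex ℝ bc.space := by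
  cases bc
  · exact convex_Icc 0 1
  · exact convex_univ

theorem BdryKind.Icc_subset_space (bc : BdryKind) : Icc (0 : ℝ) 1 ⊆ bc.space := by
  cases bc
  · exact subset_rfl
  · exact subset_univ _

theorem BdryKind.zero_mem_space (bc : BdryKind) : (0 : ℝ) ∈ bc.space :=
  bc.Icc_subset_space (by simp)

theorem BdryKind.one_mem_space (bc : BdryKind) : (1 : ℝ) ∈ bc.space :=
  bc.Icc_subset_space (by simp)

theorem BdryKind.uniqueDiffOn_space (bc : BdryKind) : UniqueDiffOn ℝ bc.space := by
  cases bc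
  · exact uniqueDiffOn_Icc zero_lt_one
  · exact uniqueDiffOn_univ

theorem BdryKind.uIcc_subset_space (bc : BdryKind) {x y : ℝ} (hx : x ∈ bc.space)
    (hy : y ∈ bc.space) : uIcc x y ⊆ bc.space := by
  rw [← segment_eq_uIcc]
  exact bc.convex_space.segment_subset hx hy

/-- The nearest point retraction of the line onto the spatial domain. -/
noncomputable def BdryKind.retract : BdryKind → ℝ → ℝ
  | .dirichlet, x => max 0 (min 1 x)
  | .periodic, x => x

theorem BdryKind.retract_mem (bc : BdryKind) (x : ℝ) : bc.retract x ∈ bc.space := by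
  cases bc
  · simp [retract, space]
  · simp [space]

theorem BdryKind.retract_of_mem (bc : BdryKind) {x : ℝ} (hx : x ∈ bc.space) :
    bc.retract x = x := by
  cases bc
  · obtain ⟨h0, h1⟩ := hx
    simp [retract, h0, h1]
  · rfl

theorem BdryKind.lipschitz_retract (bc : BdryKind) : LipschitzWith 1 bc.retract := by
  cases bc
  · exact (LipschitzWith.id.const_min 1).const_max 0
  · exact LipschitzWith.id

theorem BdryKind.continuous_retract (bc : BdryKind) : Continuous bc.retract :=
  bc.lipschitz_retract.continuous

theorem zero_mem_timeIvl {T : EReal} (hT : 0 < T) : (0 : ℝ) ∈ timeIvl T :=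
  ⟨le_rfl, by simpa using hT⟩

theorem Icc_subset_timeIvl {T : EReal} {t : ℝ} (ht : t ∈ timeIvl T) : Icc 0 t ⊆ timeIvl T :=
  fun _ hs => ⟨hs.1, lt_of_le_of_lt (EReal.coe_le_coe_iff.2 hs.2) ht.2⟩

theorem convex_timeIvl (T : EReal) : Convex ℝ (timeIvl T) := by
  refine Set.OrdConnected.convex ⟨fun x hx y hy z hz => ?_⟩
  exact Icc_subset_timeIvl hy ⟨hx.1.trans hz.1, hz.2⟩

theorem exists_gt_mem_timeIvl {T : EReal} {t : ℝ} (ht : t ∈ timeIvl T) :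
    ∃ τ ∈ timeIvl T, t < τ := by
  obtain ⟨τ, h1, h2⟩ := EReal.lt_iff_exists_real_btwn.1 ht.2
  have h1' := EReal.coe_lt_coe_iff.1 h1
  exact ⟨τ, ⟨ht.1.trans h1'.le, h2⟩, h1'⟩

theorem uniqueDiffOn_timeIvl {T : EReal} (hT : 0 < T) : UniqueDiffOn ℝ (timeIvl T) := by
  refine uniqueDiffOn_convex (convex_timeIvl T) ?_
  obtain ⟨τ, hτ, h0⟩ := exists_gt_mem_timeIvl (zero_mem_timeIvl hT)
  refine Nonempty.mono (interior_mono (Icc_subset_timeIvl hτ)) ?_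
  rw [interior_Icc]
  exact nonempty_Ioo.2 h0

theorem Icc_mem_nhdsWithin_timeIvl {T : EReal} {t τ : ℝ} (h : t < τ) :
    Icc 0 τ ∈ 𝓝[timeIvl T] t := by
  filter_upwards [self_mem_nhdsWithin, mem_nhdsWithin_of_mem_nhds (Iio_mem_nhds h)] with s hs hs'
  exact ⟨hs.1, hs'.le⟩

theorem zero_mem_timeIvl_of_mem {T : EReal} {t : ℝ} (ht : t ∈ timeIvl T) :
    (0 : ℝ) ∈ timeIvl T := Icc_subset_timeIvl ht ⟨le_rfl, ht.1⟩

theorem pos_of_mem_timeIvl {T : EReal} {t : ℝ} (ht : t ∈ timeIvl T) : 0 < T := by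
  simpa using (zero_mem_timeIvl_of_mem ht).2

/-! ### Jointly smooth functions on a product of subsets of the line -/

/-- `f` is jointly smooth on `A × B`. -/
def JointSmooth (A B : Set ℝ) (f : ℝ → ℝ → ℝ) : Prop :=
  ContDiffOn ℝ ∞ (fun q : ℝ × ℝ => f q.1 q.2) (A ×ˢ B)

namespace JointSmooth

variable {A B : Set ℝ} {f g : ℝ → ℝ → ℝ}

theorem continuousOn (hf : JointSmooth A B f) :
    ContinuousOn (fun q : ℝ × ℝ => f q.1 q.2) (A ×ˢ B) :=
  ContDiffOn.continuousOn hf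

theorem mono {A' B' : Set ℝ} (hf : JointSmooth A B f) (hA : A' ⊆ A) (hB : B' ⊆ B) :
    JointSmooth A' B' f := ContDiffOn.mono hf (prod_mono hA hB)

theorem congr (hf : JointSmooth A B f) (h : ∀ x ∈ A, ∀ t ∈ B, g x t = f x t) :
    JointSmooth A B g := ContDiffOn.congr hf fun q hq => h q.1 hq.1 q.2 hq.2

theorem add (hf : JointSmooth A B f) (hg : JointSmooth A B g) :
    JointSmooth A B fun x t => f x t + g x t := ContDiffOn.add hf hg

theorem sub (hf : JointSmooth A B f) (hg : JointSmooth A B g) :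
    JointSmooth A B fun x t => f x t - g x t := ContDiffOn.sub hf hg

theorem mul (hf : JointSmooth A B f) (hg : JointSmooth A B g) :
    JointSmooth A B fun x t => f x t * g x t := ContDiffOn.mul hf hg

theorem const (c : ℝ) : JointSmooth A B fun _ _ => c := contDiffOn_const

theorem of_fst {h : ℝ → ℝ} (hh : ContDiffOn ℝ ∞ h A) : JointSmooth A B fun x _ => h x :=
  hh.comp contDiffOn_fst fun _ hq => hq.1

theorem of_snd {h : ℝ → ℝ} (hh : ContDiffOn ℝ ∞ h B) : JointSmooth A B fun _ t => h t :=
  hh.comp contDiffOn_snd fun _ hq => hq.2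

theorem contDiffOn_fst (hf : JointSmooth A B f) {t : ℝ} (ht : t ∈ B) :
    ContDiffOn ℝ ∞ (fun x => f x t) A :=
  ContDiffOn.comp (t := A ×ˢ B) hf (f := fun x => (x, t)) (contDiffOn_id.prodMk contDiffOn_const)
    fun _ hx => ⟨hx, ht⟩

theorem contDiffOn_snd (hf : JointSmooth A B f) {x : ℝ} (hx : x ∈ A) :
    ContDiffOn ℝ ∞ (fun t => f x t) B :=
  ContDiffOn.comp (t := A ×ˢ B) hf (f := fun t => (x, t)) (contDiffOn_const.prodMk contDiffOn_id)
    fun _ ht => ⟨hx, ht⟩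

theorem hasFDerivWithinAt (hf : JointSmooth A B f) {x t : ℝ} (hx : x ∈ A) (ht : t ∈ B) :
    HasFDerivWithinAt (fun q : ℝ × ℝ => f q.1 q.2)
      (fderivWithin ℝ (fun q : ℝ × ℝ => f q.1 q.2) (A ×ˢ B) (x, t)) (A ×ˢ B) (x, t) :=
  ((ContDiffOn.differentiableOn hf (by simp)) (x, t) ⟨hx, ht⟩).hasFDerivWithinAt

theorem derivWithin_fst (hf : JointSmooth A B f) (hA : UniqueDiffOn ℝ A) {x t : ℝ} (hx : x ∈ A)
    (ht : t ∈ B) :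
    derivWithin (fun y => f y t) A x =
      fderivWithin ℝ (fun q : ℝ × ℝ => f q.1 q.2) (A ×ˢ B) (x, t) (1, 0) :=
  HasDerivWithinAt.derivWithin ((hf.hasFDerivWithinAt hx ht).comp_hasDerivWithinAt x
    (f := fun y => (y, t)) ((hasDerivWithinAt_id x A).prodMk (hasDerivWithinAt_const x A t))
    fun _ hy => ⟨hy, ht⟩) (hA x hx)

theorem derivWithin_snd (hf : JointSmooth A B f) (hB : UniqueDiffOn ℝ B) {x t : ℝ} (hx : x ∈ A)
    (ht : t ∈ B) :
    derivWithin (fun s => f x s) B t =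
      fderivWithin ℝ (fun q : ℝ × ℝ => f q.1 q.2) (A ×ˢ B) (x, t) (0, 1) :=
  HasDerivWithinAt.derivWithin ((hf.hasFDerivWithinAt hx ht).comp_hasDerivWithinAt t
    (f := fun s => (x, s)) ((hasDerivWithinAt_const t B x).prodMk (hasDerivWithinAt_id t B))
    fun _ hs => ⟨hx, hs⟩) (hB t ht)

theorem partial_fst (hf : JointSmooth A B f) (hA : UniqueDiffOn ℝ A) (hB : UniqueDiffOn ℝ B) :
    JointSmooth A B fun x t => derivWithin (fun y => f y t) A x := by
  have h : ContDiffOn ℝ ∞ (fderivWithin ℝ (fun q : ℝ × ℝ => f q.1 q.2) (A ×ˢ B)) (A ×ˢ B) :=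
    ContDiffOn.fderivWithin hf (hA.prod hB) (by simp)
  exact (h.clm_apply contDiffOn_const).congr fun q hq => hf.derivWithin_fst hA hq.1 hq.2

theorem partial_snd (hf : JointSmooth A B f) (hA : UniqueDiffOn ℝ A) (hB : UniqueDiffOn ℝ B) :
    JointSmooth A B fun x t => derivWithin (fun s => f x s) B t := by
  have h : ContDiffOn ℝ ∞ (fderivWithin ℝ (fun q : ℝ × ℝ => f q.1 q.2) (A ×ˢ B)) (A ×ˢ B) :=
    ContDiffOn.fderivWithin hf (hA.prod hB) (by simp)
  exact (h.clm_apply contDiffOn_const).congr fun q hq => hf.derivWithin_snd hB hq.1 hq.2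

theorem hasDerivWithinAt_fst (hf : JointSmooth A B f) {x t : ℝ} (hx : x ∈ A) (ht : t ∈ B) :
    HasDerivWithinAt (fun y => f y t) (derivWithin (fun y => f y t) A x) A x :=
  (((hf.contDiffOn_fst ht).differentiableOn (by simp)) x hx).hasDerivWithinAt

theorem hasDerivWithinAt_snd (hf : JointSmooth A B f) {x t : ℝ} (hx : x ∈ A) (ht : t ∈ B) :
    HasDerivWithinAt (fun s => f x s) (derivWithin (fun s => f x s) B t) B t :=
  (((hf.contDiffOn_snd hx).differentiableOn (by simp)) t ht).hasDerivWithinAt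

/-- The chain rule along a curve in `A` parametrized by time. -/
theorem hasDerivWithinAt_curve (hf : JointSmooth A B f) (hA : UniqueDiffOn ℝ A)
    (hB : UniqueDiffOn ℝ B) {c : ℝ → ℝ} {c' t : ℝ} (hc : MapsTo c B A) (ht : t ∈ B)
    (h : HasDerivWithinAt c c' B t) :
    HasDerivWithinAt (fun s => f (c s) s)
      (derivWithin (fun s => f (c t) s) B t + c' * derivWithin (fun y => f y t) A (c t)) B t := by
  rw [hf.derivWithin_fst hA (hc ht) ht, hf.derivWithin_snd hB (hc ht) ht]
  have := (hf.hasFDerivWithinAt (hc ht) ht).comp_hasDerivWithinAt t (f := fun s => (c s, s))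
    (h.prodMk (hasDerivWithinAt_id t B)) fun s hs => ⟨hc hs, hs⟩
  convert! this using 1
  have e : ((c', 1) : ℝ × ℝ) = (0, 1) + c' • (1, 0) := by simp
  rw [e, map_add, map_smul, smul_eq_mul]

/-- The chain rule for a substitution in the space variable. -/
theorem comp_fst {A' : Set ℝ} (hf : JointSmooth A B f) (hg : JointSmooth A' B g)
    (h : ∀ x ∈ A', ∀ t ∈ B, g x t ∈ A) : JointSmooth A' B fun x t => f (g x t) t := by
  have h2 : ContDiffOn ℝ ∞ (fun q : ℝ × ℝ => (g q.1 q.2, q.2)) (A' ×ˢ B) :=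
    ContDiffOn.prodMk (f := fun q : ℝ × ℝ => g q.1 q.2) hg _root_.contDiffOn_snd
  exact ContDiffOn.comp (t := A ×ˢ B) hf h2 fun q hq => ⟨h q.1 hq.1 q.2 hq.2, hq.2⟩

end JointSmooth

/-- A function on the spatial domain times a compact time interval, periodic in the periodic
setting, is bounded. -/
theorem exists_bound_of_continuousOn {bc : BdryKind} {f : ℝ → ℝ → ℝ} {τ : ℝ}
    (hf : ContinuousOn (fun q : ℝ × ℝ => f q.1 q.2) (bc.space ×ˢ Icc 0 τ))
    (hp : bc = .periodic → ∀ t ∈ Icc 0 τ, ∀ x, f (x + 1) t = f x t) :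
    ∃ K : ℝ, 0 ≤ K ∧ ∀ x ∈ bc.space, ∀ t ∈ Icc 0 τ, |f x t| ≤ K := by
  obtain ⟨K, hK⟩ := (isCompact_Icc.prod isCompact_Icc).exists_bound_of_continuousOn
    (hf.mono (prod_mono bc.Icc_subset_space subset_rfl))
  refine ⟨max K 0, le_max_right _ _, fun x hx t ht => le_trans ?_ (le_max_left _ _)⟩
  cases bc with
  | dirichlet => exact hK (x, t) ⟨hx, ht⟩
  | periodic =>
    have hper : Function.Periodic (fun y => f y t) 1 := hp rfl t ht
    have := hper.sub_int_mul_eq ⌊x⌋ (x := x)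
    simp only [mul_one] at this
    rw [← this]
    refine hK (x - ⌊x⌋, t) ⟨⟨?_, ?_⟩, ht⟩
    · exact sub_nonneg.2 (Int.floor_le x)
    · linarith [Int.lt_floor_add_one x]

/-! ### Comparison of scalar trajectories and existence of the flow -/

/-- Gronwall in both time directions. The square, unlike the absolute value, is differentiable, and
its derivative 2δδ' lies between -2Kδ² and 2Kδ². -/
theorem mul_exp_monotoneOn_of_abs_deriv_le {δ δ' : ℝ → ℝ} {τ K : ℝ}
    (h : ∀ s ∈ Icc 0 τ, HasDerivWithinAt δ (δ' s) (Icc 0 τ) s)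
    (hK : ∀ s ∈ Icc 0 τ, |δ' s| ≤ K * |δ s|) :
    MonotoneOn (fun s => δ s ^ 2 * Real.exp (2 * K * s)) (Icc 0 τ) ∧
      AntitoneOn (fun s => δ s ^ 2 * Real.exp (-(2 * K) * s)) (Icc 0 τ) := by
  have hd : ∀ c : ℝ, ∀ s ∈ Icc 0 τ, HasDerivWithinAt (fun s => δ s ^ 2 * Real.exp (c * s))
      ((2 * (δ s * δ' s) + c * δ s ^ 2) * Real.exp (c * s)) (Icc 0 τ) s := fun c s hs => by
    have h1 := (h s hs).pow 2
    have h2 := ((hasDerivWithinAt_id s (Icc 0 τ)).const_mul c).exp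
    convert! h1.mul h2 using 1
    simp only [id, Pi.pow_apply]
    ring
  have hb : ∀ s ∈ Icc 0 τ, |δ s * δ' s| ≤ K * δ s ^ 2 := fun s hs => by
    rw [abs_mul, ← sq_abs]
    nlinarith [hK s hs, abs_nonneg (δ s)]
  constructor
  · refine monotoneOn_of_hasDerivWithinAt_nonneg (convex_Icc 0 τ)
      (fun s hs => (hd _ s hs).continuousWithinAt)
      (fun s hs => (hd _ s (interior_subset hs)).mono interior_subset) fun s hs => ?_
    have := abs_le.1 (hb s (interior_subset hs))
    exact mul_nonneg (by linarith) (Real.exp_pos _).le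
  · refine antitoneOn_of_hasDerivWithinAt_nonpos (convex_Icc 0 τ)
      (fun s hs => (hd _ s hs).continuousWithinAt)
      (fun s hs => (hd _ s (interior_subset hs)).mono interior_subset) fun s hs => ?_
    have := abs_le.1 (hb s (interior_subset hs))
    exact mul_nonpos_of_nonpos_of_nonneg (by linarith) (Real.exp_pos _).le

theorem abs_le_exp_mul_of_abs_deriv_le {δ δ' : ℝ → ℝ} {τ K : ℝ}
    (h : ∀ s ∈ Icc 0 τ, HasDerivWithinAt δ (δ' s) (Icc 0 τ) s)
    (hK : ∀ s ∈ Icc 0 τ, |δ' s| ≤ K * |δ s|) {t : ℝ} (ht : t ∈ Icc 0 τ) :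
    |δ t| ≤ Real.exp (K * t) * |δ 0| := by
  have h1 := (mul_exp_monotoneOn_of_abs_deriv_le h hK).2 ⟨le_rfl, ht.1.trans ht.2⟩ ht ht.1
  refine (sq_le_sq₀ (abs_nonneg _) (by positivity)).1 ?_
  rw [sq_abs]
  simp only [mul_zero, Real.exp_zero, mul_one, neg_mul, Real.exp_neg] at h1
  rw [← div_eq_mul_inv, div_le_iff₀ (Real.exp_pos _)] at h1
  rw [mul_pow, sq_abs, ← Real.exp_nat_mul]
  refine h1.trans_eq ?_
  rw [mul_comm]
  congr 2
  push_cast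
  ring

theorem abs_zero_le_exp_mul_of_abs_deriv_le {δ δ' : ℝ → ℝ} {τ K : ℝ}
    (h : ∀ s ∈ Icc 0 τ, HasDerivWithinAt δ (δ' s) (Icc 0 τ) s)
    (hK : ∀ s ∈ Icc 0 τ, |δ' s| ≤ K * |δ s|) {t : ℝ} (ht : t ∈ Icc 0 τ) :
    |δ 0| ≤ Real.exp (K * t) * |δ t| := by
  have h1 := (mul_exp_monotoneOn_of_abs_deriv_le h hK).1 ⟨le_rfl, ht.1.trans ht.2⟩ ht ht.1
  refine (sq_le_sq₀ (abs_nonneg _) (by positivity)).1 ?_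
  rw [sq_abs]
  simp only [mul_zero, Real.exp_zero, mul_one] at h1
  rw [mul_pow, sq_abs, ← Real.exp_nat_mul]
  refine h1.trans_eq ?_
  rw [mul_comm]
  congr 2
  push_cast
  ring

/-- A negative value would force a zero at some earlier time. The backward estimate then gives δ(0)
= 0 and the forward one δ = 0 throughout. This keeps trajectories from crossing a wall. -/
theorem nonneg_of_abs_deriv_le {δ δ' : ℝ → ℝ} {τ K : ℝ}
    (h : ∀ s ∈ Icc 0 τ, HasDerivWithinAt δ (δ' s) (Icc 0 τ) s)
    (hK : ∀ s ∈ Icc 0 τ, |δ' s| ≤ K * |δ s|) (h0 : 0 ≤ δ 0) {t : ℝ} (ht : t ∈ Icc 0 τ) :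
    0 ≤ δ t := by
  by_contra! hneg
  have hc : ContinuousOn δ (Icc 0 t) := fun s hs =>
    ((h s ⟨hs.1, hs.2.trans ht.2⟩).continuousWithinAt).mono (Icc_subset_Icc_right ht.2)
  obtain ⟨s, hs, hs0⟩ := intermediate_value_Icc' ht.1 hc ⟨hneg.le, h0⟩
  have h1 := abs_zero_le_exp_mul_of_abs_deriv_le h hK (t := s) ⟨hs.1, hs.2.trans ht.2⟩
  rw [hs0, abs_zero, mul_zero] at h1
  have h2 := abs_le_exp_mul_of_abs_deriv_le h hK ht
  have h3 : |δ t| ≤ 0 := h2.trans (mul_nonpos_of_nonneg_of_nonpos (Real.exp_pos _).le h1)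
  rw [abs_nonpos_iff] at h3
  exact hneg.ne h3

/-- A vector field which is bounded, continuous in time and globally Lipschitz in space on a
compact time interval has trajectories on all of it. -/
theorem exists_trajectory_Icc {v : ℝ → ℝ → ℝ} {τ K L : ℝ} (hτ : 0 ≤ τ) (hK : 0 ≤ K) (hL : 0 ≤ L)
    (hlip : ∀ t ∈ Icc 0 τ, ∀ x y, |v x t - v y t| ≤ K * |x - y|)
    (hbd : ∀ t ∈ Icc 0 τ, ∀ x, |v x t| ≤ L)
    (hcont : ∀ x, ContinuousOn (v x) (Icc 0 τ)) (α : ℝ) :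
    ∃ c : ℝ → ℝ, c 0 = α ∧ ∀ t ∈ Icc 0 τ, HasDerivWithinAt c (v (c t) t) (Icc 0 τ) t := by
  -- The ball of radius Lτ cannot be left within time τ at speed at most L, so there is no
  -- restriction on τ.
  have : IsPicardLindelof (fun t x => v x t) (tmin := 0) (tmax := τ) ⟨0, le_rfl, hτ⟩ α
      (⟨L * τ, mul_nonneg hL hτ⟩) 0 ⟨L, hL⟩ ⟨K, hK⟩ :=
    { lipschitzOnWith := fun t ht => LipschitzOnWith.of_dist_le_mul fun x _ y _ => hlip t ht x y
      continuousOn := fun x _ => hcont x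
      norm_le := fun t ht x _ => hbd t ht x
      mul_max_le := by
        simp only [sub_zero, sub_self, max_eq_left hτ, NNReal.coe_zero]
        exact le_rfl }
  exact this.exists_eq_forall_mem_Icc_hasDerivWithinAt₀

section Flow

variable {bc : BdryKind} {T : EReal} {u : ℝ → ℝ → ℝ}

theorem partialX_periodic {f : ℝ → ℝ → ℝ} {t : ℝ} (hf : ∀ x, f (x + 1) t = f x t) (x : ℝ) :
    partialX .periodic f (x + 1) t = partialX .periodic f x t := by
  simp only [partialX, BdryKind.space, derivWithin_univ]
  rw [← deriv_comp_add_const]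
  simp only [hf]

theorem exists_lipschitz_of_jointSmooth (hu : JointSmooth bc.space (timeIvl T) u)
    (hb : ∀ t ∈ timeIvl T, bc.Holds fun x => u x t) {τ : ℝ} (hτ : τ ∈ timeIvl T) :
    ∃ K : ℝ, 0 ≤ K ∧ ∀ t ∈ Icc 0 τ, ∀ x ∈ bc.space, ∀ y ∈ bc.space,
      |u x t - u y t| ≤ K * |x - y| := by
  have hsub := Icc_subset_timeIvl hτ
  have hT := uniqueDiffOn_timeIvl (pos_of_mem_timeIvl hτ)
  obtain ⟨K, hK0, hK⟩ := exists_bound_of_continuousOn (bc := bc) (τ := τ) (f := partialX bc u)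
    ((hu.partial_fst bc.uniqueDiffOn_space hT).continuousOn.mono (prod_mono subset_rfl hsub))
    (by
      rintro rfl t ht x
      exact partialX_periodic (hb t (hsub ht)) x)
  refine ⟨K, hK0, fun t ht x hx y hy => ?_⟩
  exact bc.convex_space.norm_image_sub_le_of_norm_hasDerivWithin_le
    (fun z hz => hu.hasDerivWithinAt_fst hz (hsub ht)) (fun z hz => hK z hz t ht) hy hx

/-- Precomposing with the retraction extends the velocity to a globally Lipschitz field on the line.
In the Dirichlet setting the walls are its zeros, so the trajectory stays in [0,1], where the
extension agrees with `u`. -/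
theorem exists_trajectory_of_jointSmooth (hu : JointSmooth bc.space (timeIvl T) u)
    (hb : ∀ t ∈ timeIvl T, bc.Holds fun x => u x t) {τ : ℝ} (hτ : τ ∈ timeIvl T) {α : ℝ}
    (hα : α ∈ bc.space) :
    ∃ c : ℝ → ℝ, c 0 = α ∧ (∀ t ∈ Icc 0 τ, c t ∈ bc.space) ∧
      ∀ t ∈ Icc 0 τ, HasDerivWithinAt c (u (c t) t) (Icc 0 τ) t := by
  have hsub := Icc_subset_timeIvl hτ
  obtain ⟨K, hK0, hK⟩ := exists_lipschitz_of_jointSmooth hu hb hτ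
  obtain ⟨L, hL0, hL⟩ := exists_bound_of_continuousOn (bc := bc) (τ := τ) (f := u)
    (hu.continuousOn.mono (prod_mono subset_rfl hsub)) (by
      rintro rfl t ht x
      exact hb t (hsub ht) x)
  have hlip : ∀ t ∈ Icc 0 τ, ∀ x y, |u (bc.retract x) t - u (bc.retract y) t| ≤ K * |x - y| := by
    intro t ht x y
    refine (hK t ht _ (bc.retract_mem x) _ (bc.retract_mem y)).trans ?_
    have := bc.lipschitz_retract.dist_le_mul x y
    rw [NNReal.coe_one, one_mul] at this
    exact mul_le_mul_of_nonneg_left this hK0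
  obtain ⟨c, hc0, hc⟩ := exists_trajectory_Icc (v := fun x t => u (bc.retract x) t) hτ.1 hK0 hL0
    hlip (fun t ht x => hL _ (bc.retract_mem x) t ht)
    (fun x => (hu.contDiffOn_snd (bc.retract_mem x)).continuousOn.mono hsub) α
  have hmem : ∀ t ∈ Icc 0 τ, c t ∈ bc.space := by
    intro t ht
    cases bc with
    | periodic => exact mem_univ _
    | dirichlet =>
      have hr0 : BdryKind.dirichlet.retract 0 = 0 :=
        BdryKind.retract_of_mem _ (BdryKind.zero_mem_space _)
      have hr1 : BdryKind.dirichlet.retract 1 = 1 :=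
        BdryKind.retract_of_mem _ (BdryKind.one_mem_space _)
      constructor
      · refine nonneg_of_abs_deriv_le hc (K := K) (fun s hs => ?_) (by rw [hc0]; exact hα.1) ht
        have := hlip s hs (c s) 0
        have h0 : u 0 s = 0 := (hb s (hsub hs)).1
        rwa [hr0, h0, sub_zero, sub_zero] at this
      · have := nonneg_of_abs_deriv_le (δ := fun s => 1 - c s) (K := K)
          (fun s hs => (hc s hs).const_sub 1) (fun s hs => ?_)
          (by simp only [hc0, sub_nonneg]; exact hα.2) ht
        · simpa using this
        · have := hlip s hs (c s) 1
          have h1 : u 1 s = 0 := (hb s (hsub hs)).2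
          rw [hr1, h1, sub_zero, abs_sub_comm (c s)] at this
          rwa [abs_neg]
  refine ⟨c, hc0, hmem, fun t ht => ?_⟩
  have := hc t ht
  rwa [bc.retract_of_mem (hmem t ht)] at this

theorem abs_sub_trajectory_le {τ K : ℝ}
    (hK : ∀ t ∈ Icc 0 τ, ∀ x ∈ bc.space, ∀ y ∈ bc.space, |u x t - u y t| ≤ K * |x - y|)
    {c d : ℝ → ℝ} (hcm : ∀ t ∈ Icc 0 τ, c t ∈ bc.space) (hdm : ∀ t ∈ Icc 0 τ, d t ∈ bc.space)
    (hc : ∀ t ∈ Icc 0 τ, HasDerivWithinAt c (u (c t) t) (Icc 0 τ) t)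
    (hd : ∀ t ∈ Icc 0 τ, HasDerivWithinAt d (u (d t) t) (Icc 0 τ) t) {t : ℝ} (ht : t ∈ Icc 0 τ) :
    |c t - d t| ≤ Real.exp (K * t) * |c 0 - d 0| ∧
      |c 0 - d 0| ≤ Real.exp (K * t) * |c t - d t| :=
  have h := fun s hs => (hc s hs).sub (hd s hs)
  have h' := fun s hs => hK s hs _ (hcm s hs) _ (hdm s hs)
  ⟨abs_le_exp_mul_of_abs_deriv_le (δ := fun s => c s - d s) h h' ht,
    abs_zero_le_exp_mul_of_abs_deriv_le (δ := fun s => c s - d s) h h' ht⟩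

/-- The Lagrangian trajectories of a smooth velocity exist for all times. -/
theorem exists_isFlow (hu : JointSmooth bc.space (timeIvl T) u)
    (hb : ∀ t ∈ timeIvl T, bc.Holds fun x => u x t) (hT : 0 < T) : ∃ γ, IsFlow bc T u γ := by
  have key : ∀ α τ : ℝ, ∃ c : ℝ → ℝ, α ∈ bc.space → τ ∈ timeIvl T →
      c 0 = α ∧ (∀ t ∈ Icc 0 τ, c t ∈ bc.space) ∧
      ∀ t ∈ Icc 0 τ, HasDerivWithinAt c (u (c t) t) (Icc 0 τ) t := fun α τ => by
    by_cases h : α ∈ bc.space ∧ τ ∈ timeIvl T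
    · obtain ⟨c, hc⟩ := exists_trajectory_of_jointSmooth hu hb h.2 h.1
      exact ⟨c, fun _ _ => hc⟩
    · exact ⟨0, fun h1 h2 => (h ⟨h1, h2⟩).elim⟩
  choose c hc using key
  -- Trajectories on different compact intervals coincide where both are defined, so the diagonal
  -- value `c α t t` glues them into one on [0,T).
  have agree : ∀ α ∈ bc.space, ∀ τ ∈ timeIvl T, ∀ t ∈ Icc 0 τ, c α t t = c α τ t := by
    intro α hα τ hτ t ht
    have htT := Icc_subset_timeIvl hτ ht
    obtain ⟨K, hK0, hK⟩ := exists_lipschitz_of_jointSmooth hu hb htT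
    obtain ⟨h1, h2, h3⟩ := hc α t hα htT
    obtain ⟨h4, h5, h6⟩ := hc α τ hα hτ
    have hst : Icc 0 t ⊆ Icc 0 τ := Icc_subset_Icc_right ht.2
    have := (abs_sub_trajectory_le hK h2 (fun s hs => h5 s (hst hs)) h3
      (fun s hs => (h6 s (hst hs)).mono hst) (t := t) ⟨ht.1, le_rfl⟩).1
    rw [h1, h4, sub_self, abs_zero, mul_zero, abs_nonpos_iff, sub_eq_zero] at this
    exact this
  refine ⟨fun α t => c α t t, ⟨fun α hα t ht => (hc α t hα ht).2.1 t ⟨ht.1, le_rfl⟩,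
    fun α hα => ?_, fun α hα t ht => ?_⟩⟩
  · exact (hc α 0 hα (zero_mem_timeIvl hT)).1
  · obtain ⟨τ, hτ, htτ⟩ := exists_gt_mem_timeIvl ht
    have h := ((hc α τ hα hτ).2.2 t ⟨ht.1, htτ.le⟩).mono_of_mem_nhdsWithin
      (Icc_mem_nhdsWithin_timeIvl (T := T) htτ)
    rw [← agree α hα τ hτ t ⟨ht.1, htτ.le⟩] at h
    refine h.congr_of_eventuallyEq ?_ (agree α hα τ hτ t ⟨ht.1, htτ.le⟩)
    filter_upwards [Icc_mem_nhdsWithin_timeIvl (T := T) htτ] with s hs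
    exact agree α hα τ hτ s hs

end Flow

/-! ### Primitives and integrals depending on a parameter -/

theorem eq_of_hasDerivWithinAt_zero {S : Set ℝ} (hS : Convex ℝ S) {f : ℝ → ℝ}
    (hf : ∀ x ∈ S, HasDerivWithinAt f 0 S x) {x y : ℝ} (hx : x ∈ S) (hy : y ∈ S) : f x = f y := by
  have := hS.norm_image_sub_le_of_norm_hasDerivWithin_le (C := 0) hf (by simp) hy hx
  rwa [zero_mul, norm_le_zero_iff, sub_eq_zero] at this

theorem hasDerivWithinAt_primitive_Icc {a : ℝ → ℝ} {τ : ℝ} (ha : ContinuousOn a (Icc 0 τ)) {s : ℝ}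
    (hs : s ∈ Icc 0 τ) : HasDerivWithinAt (fun r => ∫ x in (0 : ℝ)..r, a x) (a s) (Icc 0 τ) s := by
  have hτ : 0 ≤ τ := hs.1.trans hs.2
  -- Extending by constants beyond the end points gives a continuous integrand on the line, so the
  -- end points need no separate treatment.
  set e : ℝ → ℝ := IccExtend hτ ((Icc 0 τ).domRestrict a)
  have he : Continuous e := (continuousOn_iff_continuous_domRestrict.1 ha).Icc_extend'
  have heq : ∀ r ∈ Icc 0 τ, e r = a r := fun r hr => by
    rw [show e r = _ from IccExtend_of_mem hτ _ hr]
    rfl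
  have h : HasDerivAt (fun r => ∫ x in (0 : ℝ)..r, e x) (e s) s :=
    (he.integral_hasStrictDerivAt 0 s).hasDerivAt
  rw [heq s hs] at h
  refine h.hasDerivWithinAt.congr_of_mem (fun r hr => ?_) hs
  refine intervalIntegral.integral_congr fun x hx => ?_
  rw [uIcc_of_le hr.1] at hx
  exact (heq x ⟨hx.1, hx.2.trans hr.2⟩).symm

/-- The solution of a scalar linear differential equation. -/
theorem eq_mul_exp_integral_of_hasDerivWithinAt {δ a : ℝ → ℝ} {τ : ℝ}
    (hτ : 0 ≤ τ) (ha : ContinuousOn a (Icc 0 τ))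
    (h : ∀ s ∈ Icc 0 τ, HasDerivWithinAt δ (a s * δ s) (Icc 0 τ) s) :
    δ τ = δ 0 * Real.exp (∫ s in (0 : ℝ)..τ, a s) := by
  have hd : ∀ s ∈ Icc 0 τ,
      HasDerivWithinAt (fun s => δ s * Real.exp (-∫ r in (0 : ℝ)..s, a r)) 0 (Icc 0 τ) s := by
    intro s hs
    convert! (h s hs).mul (hasDerivWithinAt_primitive_Icc ha hs).neg.exp using 1
    ring
  have := eq_of_hasDerivWithinAt_zero (convex_Icc 0 τ) hd ⟨hτ, le_rfl⟩ ⟨le_rfl, hτ⟩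
  simp only [intervalIntegral.integral_same, neg_zero, Real.exp_zero, mul_one, Real.exp_neg] at this
  rw [← this, inv_mul_cancel_right₀ (Real.exp_ne_zero _)]

theorem hasDerivAt_integral_of_continuous {h h' : ℝ → ℝ → ℝ}
    (hh : Continuous fun q : ℝ × ℝ => h q.1 q.2) (hh' : Continuous fun q : ℝ × ℝ => h' q.1 q.2)
    (hd : ∀ y t, HasDerivAt (h y) (h' y t) t) (a b t : ℝ) :
    HasDerivAt (fun s => ∫ y in a..b, h y s) (∫ y in a..b, h' y t) t := by
  obtain ⟨C, hC⟩ := (isCompact_uIcc (a := a) (b := b)).prod (isCompact_closedBall t 1)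
    |>.exists_bound_of_continuousOn hh'.continuousOn
  have hc : ∀ s, Continuous fun y => h y s := fun s =>
    hh.comp (by fun_prop : Continuous fun y => (y, s))
  have hc' : ∀ s, Continuous fun y => h' y s :=
    fun s => hh'.comp (by fun_prop : Continuous fun y => (y, s))
  refine (intervalIntegral.hasDerivAt_integral_of_dominated_loc_of_deriv_le
    (F := fun s y => h y s) (F' := fun s y => h' y s) (bound := fun _ => C)
    (Metric.closedBall_mem_nhds t one_pos)
    (Eventually.of_forall fun s => (hc s).aestronglyMeasurable) ((hc t).intervalIntegrable _ _)
    (hc' t).aestronglyMeasurable ?_ intervalIntegrable_const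
    (Eventually.of_forall fun y _ s _ => hd y s)).2
  exact Eventually.of_forall fun y hy s hs => hC (y, s) ⟨uIoc_subset_uIcc hy, hs⟩

/-- The two partial derivatives come from the fundamental theorem of calculus and from
differentiation under the integral. Both are jointly continuous, hence the function is jointly
differentiable. -/
theorem hasFDerivAt_parametric_primitive {h h' : ℝ → ℝ → ℝ}
    (hh : Continuous fun q : ℝ × ℝ => h q.1 q.2) (hh' : Continuous fun q : ℝ × ℝ => h' q.1 q.2)
    (hd : ∀ y t, HasDerivAt (h y) (h' y t) t) (q : ℝ × ℝ) :
    HasFDerivAt (fun q : ℝ × ℝ => ∫ y in (0 : ℝ)..q.1, h y q.2)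
      (h q.1 q.2 • ContinuousLinearMap.fst ℝ ℝ ℝ +
        (∫ y in (0 : ℝ)..q.1, h' y q.2) • ContinuousLinearMap.snd ℝ ℝ ℝ) q := by
  have hc : ∀ s, Continuous fun y => h y s := fun s =>
    hh.comp (by fun_prop : Continuous fun y => (y, s))
  have hint : Continuous fun q : ℝ × ℝ => ∫ y in (0 : ℝ)..q.1, h' y q.2 :=
    intervalIntegral.continuous_parametric_intervalIntegral_of_continuous
      (f := fun q : ℝ × ℝ => fun y => h' y q.2)
      (hh'.comp (by fun_prop : Continuous fun z : (ℝ × ℝ) × ℝ => (z.2, z.1.2))) continuous_fst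
  have := (hasStrictFDerivAt_uncurry_coprod (𝕜 := ℝ) (u := q)
    (f := fun x t => ∫ y in (0 : ℝ)..x, h y t)
    (f₁ := fun x t => h x t • ContinuousLinearMap.id ℝ ℝ)
    (f₂ := fun x t => (∫ y in (0 : ℝ)..x, h' y t) • ContinuousLinearMap.id ℝ ℝ)
    (Eventually.of_forall fun v => ?_) (Eventually.of_forall fun v => ?_) ?_ ?_).hasFDerivAt
  · refine this.congr_fderiv ?_
    ext <;> simp [Function.HasUncurry.uncurry]
  · refine ((hc v.2).integral_hasStrictDerivAt 0 v.1).hasDerivAt.hasFDerivAt.congr_fderiv ?_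
    ext; simp [Function.HasUncurry.uncurry]
  · refine (hasDerivAt_integral_of_continuous hh hh' hd 0 v.1 v.2).hasFDerivAt.congr_fderiv ?_
    ext; simp [Function.HasUncurry.uncurry]
  · exact (hh.smul continuous_const).continuousAt
  · exact (hint.smul continuous_const).continuousAt

theorem continuous_retract_of_continuousOn {bc : BdryKind} {h : ℝ → ℝ → ℝ}
    (hh : ContinuousOn (fun q : ℝ × ℝ => h q.1 q.2) (bc.space ×ˢ univ)) :
    Continuous fun q : ℝ × ℝ => h (bc.retract q.1) q.2 := by
  have := bc.continuous_retract
  rw [← continuousOn_univ]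
  exact hh.comp (f := fun q : ℝ × ℝ => (bc.retract q.1, q.2)) (by fun_prop)
    fun q _ => ⟨bc.retract_mem q.1, mem_univ _⟩

theorem integral_retract {bc : BdryKind} {h : ℝ → ℝ} {x y : ℝ} (hx : x ∈ bc.space)
    (hy : y ∈ bc.space) : ∫ z in x..y, h (bc.retract z) = ∫ z in x..y, h z :=
  intervalIntegral.integral_congr fun z hz => by
    simp only [bc.retract_of_mem (bc.uIcc_subset_space hx hy hz)]

/-- Induction on the order, for all integrands at once: the differential involves only h and the
primitive of ∂h/∂t, which is of the same kind. The retraction supplies integrands that are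
continuous on the whole line. -/
theorem contDiffOn_nat_parametric_primitive {bc : BdryKind} (n : ℕ) {h : ℝ → ℝ → ℝ}
    (hh : JointSmooth bc.space univ h) :
    ContDiffOn ℝ n (fun q : ℝ × ℝ => ∫ y in (0 : ℝ)..q.1, h y q.2) (bc.space ×ˢ univ) := by
  have hU : UniqueDiffOn ℝ (bc.space ×ˢ (univ : Set ℝ)) :=
    bc.uniqueDiffOn_space.prod uniqueDiffOn_univ
  induction n generalizing h with
  | zero =>
    rw [Nat.cast_zero, contDiffOn_zero]
    have : Continuous fun q : ℝ × ℝ => ∫ y in (0 : ℝ)..q.1, h (bc.retract y) q.2 :=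
      intervalIntegral.continuous_parametric_intervalIntegral_of_continuous
        (f := fun q : ℝ × ℝ => fun y => h (bc.retract y) q.2)
        ((continuous_retract_of_continuousOn hh.continuousOn).comp
          (by fun_prop : Continuous fun z : (ℝ × ℝ) × ℝ => (z.2, z.1.2))) continuous_fst
    refine this.continuousOn.congr fun q hq => ?_
    exact (integral_retract (h := fun y => h y q.2) bc.zero_mem_space hq.1).symm
  | succ n ih =>
    have hh' : JointSmooth bc.space univ fun x t => derivWithin (h x) univ t :=
      hh.partial_snd bc.uniqueDiffOn_space uniqueDiffOn_univ
    rw [Nat.cast_add, Nat.cast_one, contDiffOn_succ_iff_hasFDerivWithinAt_of_uniqueDiffOn hU]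
    refine ⟨by simp, fun q => h q.1 q.2 • ContinuousLinearMap.fst ℝ ℝ ℝ +
        (∫ y in (0 : ℝ)..q.1, derivWithin (h y) univ q.2) • ContinuousLinearMap.snd ℝ ℝ ℝ,
      ((ContDiffOn.of_le hh (by exact_mod_cast le_top)).smul contDiffOn_const).add
        ((ih hh').smul contDiffOn_const), fun q hq => ?_⟩
    have := hasFDerivAt_parametric_primitive
      (h := fun y t => h (bc.retract y) t)
      (h' := fun y t => derivWithin (h (bc.retract y)) univ t)
      (continuous_retract_of_continuousOn hh.continuousOn)
      (continuous_retract_of_continuousOn (h := fun x t => derivWithin (h x) univ t)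
        hh'.continuousOn)
      (fun y t => hasDerivWithinAt_univ.1 (hh.hasDerivWithinAt_snd (bc.retract_mem y) (mem_univ t))) q
    simp only [bc.retract_of_mem hq.1,
      integral_retract (h := fun y => derivWithin (h y) univ q.2) bc.zero_mem_space hq.1] at this
    refine this.hasFDerivWithinAt.congr' (fun r hr => ?_) hq
    exact (integral_retract (h := fun y => h y r.2) bc.zero_mem_space hr.1).symm

/-- Integrating a jointly smooth function in the space variable gives a jointly smooth function. -/
theorem JointSmooth.primitive {bc : BdryKind} {h : ℝ → ℝ → ℝ}
    (hh : JointSmooth bc.space univ h) :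
    JointSmooth bc.space univ fun x t => ∫ y in (0 : ℝ)..x, h y t :=
  contDiffOn_infty.2 fun n => contDiffOn_nat_parametric_primitive n hh

theorem JointSmooth.hasDerivWithinAt_primitive_fst {bc : BdryKind} {h : ℝ → ℝ → ℝ}
    (hh : JointSmooth bc.space univ h) {x : ℝ} (hx : x ∈ bc.space) (t : ℝ) :
    HasDerivWithinAt (fun x => ∫ y in (0 : ℝ)..x, h y t) (h x t) bc.space x := by
  have hc : Continuous fun y => h (bc.retract y) t :=
    (continuous_retract_of_continuousOn hh.continuousOn).comp
      (by fun_prop : Continuous fun y => (y, t))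
  have := (hc.integral_hasStrictDerivAt 0 x).hasDerivAt
  rw [bc.retract_of_mem hx] at this
  refine this.hasDerivWithinAt.congr_of_mem (fun r hr => ?_) hx
  exact (integral_retract (h := fun y => h y t) bc.zero_mem_space hr).symm

theorem JointSmooth.hasDerivAt_integral {bc : BdryKind} {h h' : ℝ → ℝ → ℝ}
    (hh : JointSmooth bc.space univ h) (hh' : JointSmooth bc.space univ h')
    (hd : ∀ y ∈ bc.space, ∀ t, HasDerivAt (h y) (h' y t) t) {x : ℝ} (hx : x ∈ bc.space) (t : ℝ) :
    HasDerivAt (fun t => ∫ y in (0 : ℝ)..x, h y t) (∫ y in (0 : ℝ)..x, h' y t) t := by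
  have := hasDerivAt_integral_of_continuous (continuous_retract_of_continuousOn hh.continuousOn)
    (continuous_retract_of_continuousOn hh'.continuousOn)
    (fun y t => hd _ (bc.retract_mem y) t) 0 x t
  rw [integral_retract (h := fun y => h' y t) bc.zero_mem_space hx] at this
  refine this.congr_of_eventuallyEq (Eventually.of_forall fun s => ?_)
  exact (integral_retract (h := fun y => h y s) bc.zero_mem_space hx).symm

/-! ### The formulas along trajectories -/

section Trajectories

variable {bc : BdryKind} {T : EReal} {u γ : ℝ → ℝ → ℝ}

theorem IsFlow.hasDerivWithinAt_Icc (hγ : IsFlow bc T u γ) {α t : ℝ} (hα : α ∈ bc.space)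
    (ht : t ∈ timeIvl T) : ∀ s ∈ Icc 0 t, HasDerivWithinAt (γ α) (u (γ α s) s) (Icc 0 t) s :=
  fun s hs => (hγ.ode α hα s (Icc_subset_timeIvl ht hs)).mono (Icc_subset_timeIvl ht)

theorem IsFlow.continuousOn (hγ : IsFlow bc T u γ) {α : ℝ} (hα : α ∈ bc.space) :
    ContinuousOn (γ α) (timeIvl T) := fun t ht => (hγ.ode α hα t ht).continuousWithinAt

/-- The upper bound makes the flow continuous in the label; the lower bound keeps distinct
trajectories apart, so that difference quotients along them make sense. -/
theorem IsFlow.exists_bilipschitz (hγ : IsFlow bc T u γ) (hu : JointSmooth bc.space (timeIvl T) u)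
    (hb : ∀ t ∈ timeIvl T, bc.Holds fun x => u x t) {t : ℝ} (ht : t ∈ timeIvl T) :
    ∃ K : ℝ, 0 ≤ K ∧ ∀ s ∈ Icc 0 t, ∀ α ∈ bc.space, ∀ β ∈ bc.space,
      |γ α s - γ β s| ≤ K * |α - β| ∧ |α - β| ≤ K * |γ α s - γ β s| := by
  obtain ⟨K, hK0, hK⟩ := exists_lipschitz_of_jointSmooth hu hb ht
  refine ⟨Real.exp (K * t), (Real.exp_pos _).le, fun s hs α hα β hβ => ?_⟩
  have hm : ∀ α ∈ bc.space, ∀ r ∈ Icc 0 t, γ α r ∈ bc.space :=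
    fun α hα r hr => hγ.mem α hα r (Icc_subset_timeIvl ht hr)
  obtain ⟨h1, h2⟩ := abs_sub_trajectory_le hK (hm α hα) (hm β hβ) (hγ.hasDerivWithinAt_Icc hα ht)
    (hγ.hasDerivWithinAt_Icc hβ ht) hs
  rw [hγ.init α hα, hγ.init β hβ] at h1 h2
  have he : Real.exp (K * s) ≤ Real.exp (K * t) :=
    Real.exp_le_exp.2 (mul_le_mul_of_nonneg_left hs.2 hK0)
  exact ⟨h1.trans (mul_le_mul_of_nonneg_right he (abs_nonneg _)),
    h2.trans (mul_le_mul_of_nonneg_right he (abs_nonneg _))⟩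

theorem IsFlow.eq_of_trajectory (hγ : IsFlow bc T u γ)
    (hu : JointSmooth bc.space (timeIvl T) u) (hb : ∀ t ∈ timeIvl T, bc.Holds fun x => u x t)
    {c : ℝ → ℝ} (hc : ∀ t ∈ timeIvl T, HasDerivWithinAt c (u (c t) t) (timeIvl T) t)
    (hcm : ∀ t ∈ timeIvl T, c t ∈ bc.space) {t : ℝ} (ht : t ∈ timeIvl T) : γ (c 0) t = c t := by
  have hsub := Icc_subset_timeIvl ht
  have h0 := hcm 0 (zero_mem_timeIvl_of_mem ht)
  obtain ⟨K, hK0, hK⟩ := exists_lipschitz_of_jointSmooth hu hb ht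
  have := (abs_sub_trajectory_le hK (fun s hs => hγ.mem _ h0 s (hsub hs))
    (fun s hs => hcm s (hsub hs)) (hγ.hasDerivWithinAt_Icc h0 ht)
    (fun s hs => (hc s (hsub hs)).mono hsub) (t := t) ⟨ht.1, le_rfl⟩).1
  rw [hγ.init _ h0, sub_self, abs_zero, mul_zero, abs_nonpos_iff, sub_eq_zero] at this
  exact this

theorem IsFlow.dirichlet_zero (hγ : IsFlow .dirichlet T u γ)
    (hu : JointSmooth BdryKind.dirichlet.space (timeIvl T) u)
    (hb : ∀ t ∈ timeIvl T, BdryKind.dirichlet.Holds fun x => u x t) {t : ℝ} (ht : t ∈ timeIvl T) :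
    γ 0 t = 0 :=
  hγ.eq_of_trajectory hu hb (c := fun _ => 0) (fun t ht => by
    have h : u 0 t = 0 := (hb t ht).1
    rw [h]
    exact hasDerivWithinAt_const _ _ _) (fun _ _ => BdryKind.zero_mem_space _) ht

theorem IsFlow.dirichlet_one (hγ : IsFlow .dirichlet T u γ)
    (hu : JointSmooth BdryKind.dirichlet.space (timeIvl T) u)
    (hb : ∀ t ∈ timeIvl T, BdryKind.dirichlet.Holds fun x => u x t) {t : ℝ} (ht : t ∈ timeIvl T) :
    γ 1 t = 1 :=
  hγ.eq_of_trajectory hu hb (c := fun _ => 1) (fun t ht => by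
    have h : u 1 t = 0 := (hb t ht).2
    rw [h]
    exact hasDerivWithinAt_const _ _ _) (fun _ _ => BdryKind.one_mem_space _) ht

/-- Both walls are stationary in the Dirichlet setting; for a periodic velocity the unit translate
of a trajectory is a trajectory. This normalizes the integral of the Jacobian to 1. -/
theorem IsFlow.one_eq (hγ : IsFlow bc T u γ) (hu : JointSmooth bc.space (timeIvl T) u)
    (hb : ∀ t ∈ timeIvl T, bc.Holds fun x => u x t) {t : ℝ} (ht : t ∈ timeIvl T) :
    γ 1 t = γ 0 t + 1 := by
  cases bc with
  | dirichlet => rw [hγ.dirichlet_zero hu hb ht, hγ.dirichlet_one hu hb ht, zero_add]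
  | periodic =>
    have := hγ.eq_of_trajectory hu hb (c := fun t => γ 0 t + 1) (fun t ht => by
      have h : u (γ 0 t + 1) t = u (γ 0 t) t := hb t ht _
      rw [h]
      exact (hγ.ode 0 (mem_univ _) t ht).add_const 1) (fun _ _ => mem_univ _) ht
    rwa [hγ.init 0 (mem_univ _), zero_add] at this

theorem IsFlow.continuousOn_comp (hγ : IsFlow bc T u γ) {f : ℝ → ℝ → ℝ}
    (hf : ContinuousOn (fun q : ℝ × ℝ => f q.1 q.2) (bc.space ×ˢ timeIvl T)) {α : ℝ}
    (hα : α ∈ bc.space) : ContinuousOn (fun t => f (γ α t) t) (timeIvl T) :=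
  hf.comp (f := fun t => (γ α t, t)) ((hγ.continuousOn hα).prodMk continuousOn_id)
    fun t ht => ⟨hγ.mem α hα t ht, ht⟩

/-- The Jacobian of the flow map of a smooth velocity. -/
theorem IsFlow.hasDerivWithinAt_exp_integral (hγ : IsFlow bc T u γ)
    (hu : JointSmooth bc.space (timeIvl T) u)
    (hb : ∀ t ∈ timeIvl T, bc.Holds fun x => u x t) {α t : ℝ} (hα : α ∈ bc.space)
    (ht : t ∈ timeIvl T) :
    HasDerivWithinAt (fun a => γ a t) (Real.exp (∫ s in (0 : ℝ)..t, partialX bc u (γ α s) s))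
      bc.space α := by
  have hsub := Icc_subset_timeIvl ht
  obtain ⟨K, hK0, hK⟩ := exists_lipschitz_of_jointSmooth hu hb ht
  obtain ⟨L, hL0, hL⟩ := hγ.exists_bilipschitz hu hb ht
  have hne : ∀ β ∈ bc.space, β ≠ α → ∀ s ∈ Icc 0 t, γ β s - γ α s ≠ 0 := by
    intro β hβ hβα s hs h
    have := (hL s hs β hβ α hα).2
    rw [h, abs_zero, mul_zero, abs_nonpos_iff, sub_eq_zero] at this
    exact hβα this
  -- With a the difference quotient of `u` between two trajectories, their separation solves δ' = aδ
  -- exactly. The slope of the flow map is therefore the exponential of ∫a, and no linearized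
  -- equation is needed.
  set a : ℝ → ℝ → ℝ := fun β s => slope (fun y => u y s) (γ α s) (γ β s)
  have ha : ∀ β ∈ bc.space, β ≠ α → ContinuousOn (a β) (Icc 0 t) := by
    intro β hβ hβα
    simp only [a, slope_def_field]
    refine ContinuousOn.div ?_ ?_ (hne β hβ hβα)
    · exact ((hγ.continuousOn_comp hu.continuousOn hβ).sub
        (hγ.continuousOn_comp hu.continuousOn hα)).mono hsub
    · exact ((hγ.continuousOn hβ).sub (hγ.continuousOn hα)).mono hsub
  have hslope : ∀ β ∈ bc.space, β ≠ α →
      slope (fun a => γ a t) α β = Real.exp (∫ s in (0 : ℝ)..t, a β s) := by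
    intro β hβ hβα
    have := eq_mul_exp_integral_of_hasDerivWithinAt (δ := fun s => γ β s - γ α s) ht.1
      (ha β hβ hβα) fun s hs => by
        convert! (hγ.hasDerivWithinAt_Icc hβ ht s hs).sub (hγ.hasDerivWithinAt_Icc hα ht s hs) using 1
        simp only [a, slope_def_field]
        rw [div_mul_cancel₀ _ (hne β hβ hβα s hs)]
    rw [slope_def_field, this, hγ.init α hα, hγ.init β hβ,
      mul_div_cancel_left₀ _ (sub_ne_zero.2 hβα)]
  rw [hasDerivWithinAt_iff_tendsto_slope]
  have hmem : ∀ᶠ β in 𝓝[bc.space \ {α}] α, β ∈ bc.space \ {α} := self_mem_nhdsWithin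
  refine Tendsto.congr' (f₁ := fun β => Real.exp (∫ s in (0 : ℝ)..t, a β s)) ?_ ?_
  · filter_upwards [hmem] with β hβ
    exact (hslope β hβ.1 hβ.2).symm
  -- As β → α the quotients converge to `u_x` on the trajectory of α, dominated by the Lipschitz
  -- constant K.
  · refine (Real.continuous_exp.tendsto _).comp ?_
    refine intervalIntegral.tendsto_integral_filter_of_dominated_convergence (fun _ => K) ?_ ?_
      intervalIntegrable_const ?_
    · filter_upwards [hmem] with β hβ
      refine ContinuousOn.aestronglyMeasurable ((ha β hβ.1 hβ.2).mono ?_) measurableSet_uIoc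
      rw [uIoc_of_le ht.1]
      exact Ioc_subset_Icc_self
    · filter_upwards [hmem] with β hβ
      refine Eventually.of_forall fun s hs => ?_
      rw [uIoc_of_le ht.1] at hs
      have hs' := Ioc_subset_Icc_self hs
      simp only [a, slope_def_field, Real.norm_eq_abs, abs_div]
      rw [div_le_iff₀ (abs_pos.2 (hne β hβ.1 hβ.2 s hs'))]
      exact hK s hs' _ (hγ.mem β hβ.1 s (hsub hs')) _ (hγ.mem α hα s (hsub hs'))
    · refine Eventually.of_forall fun s hs => ?_
      rw [uIoc_of_le ht.1] at hs
      have hs' := Ioc_subset_Icc_self hs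
      refine (hasDerivWithinAt_iff_tendsto_slope.1
        (hu.hasDerivWithinAt_fst (hγ.mem α hα s (hsub hs')) (hsub hs'))).comp ?_
      rw [tendsto_nhdsWithin_iff]
      constructor
      · rw [tendsto_iff_dist_tendsto_zero]
        refine squeeze_zero' (g := fun β => L * |β - α|)
          (Eventually.of_forall fun _ => dist_nonneg) ?_ ?_
        · filter_upwards [hmem] with β hβ
          exact (hL s hs' β hβ.1 α hα).1
        · have : Continuous fun β => L * |β - α| := by fun_prop
          have := (this.tendsto α).mono_left (nhdsWithin_le_nhds (s := bc.space \ {α}))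
          simpa using this
      · filter_upwards [hmem] with β hβ
        exact ⟨hγ.mem β hβ.1 s (hsub hs'), fun h => hne β hβ.1 hβ.2 s hs' (sub_eq_zero.2 h)⟩

end Trajectories

/-! ### Integrals of the initial velocity gradient and of its exponential -/

theorem continuousOn_derivWithin_space {bc : BdryKind} {f : ℝ → ℝ}
    (hf : ContDiffOn ℝ ∞ f bc.space) : ContinuousOn (derivWithin f bc.space) bc.space :=
  hf.continuousOn_derivWithin bc.uniqueDiffOn_space (by simp)

theorem integral_eq_sub_of_hasDerivWithinAt_space {bc : BdryKind} {f f' : ℝ → ℝ}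
    (hf : ∀ x ∈ bc.space, HasDerivWithinAt f (f' x) bc.space x)
    (hf' : ContinuousOn f' bc.space) : ∫ x in (0 : ℝ)..1, f' x = f 1 - f 0 := by
  refine intervalIntegral.integral_eq_sub_of_hasDerivAt_of_le zero_le_one
    (fun x hx => ((hf x (bc.Icc_subset_space hx)).mono bc.Icc_subset_space).continuousWithinAt)
    (fun x hx => ((hf x (bc.Icc_subset_space (Ioo_subset_Icc_self hx))).mono
      bc.Icc_subset_space).hasDerivAt (Icc_mem_nhds hx.1 hx.2)) ?_
  refine (hf'.mono ?_).intervalIntegrable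
  rw [uIcc_of_le zero_le_one]
  exact bc.Icc_subset_space

theorem BdryKind.Holds.eq_zero_one {bc : BdryKind} {f : ℝ → ℝ} (h : bc.Holds f) : f 1 = f 0 := by
  cases bc with
  | dirichlet => rw [h.1, h.2]
  | periodic => simpa using h 0

theorem contDiffOn_derivWithin_space {bc : BdryKind} {u₀ : ℝ → ℝ}
    (hu₀ : ContDiffOn ℝ ∞ u₀ bc.space) :
    ContDiffOn ℝ ∞ (derivWithin u₀ bc.space) bc.space :=
  hu₀.derivWithin bc.uniqueDiffOn_space (by simp)

theorem integral_derivWithin_eq_zero {bc : BdryKind} {u₀ : ℝ → ℝ}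
    (hu₀ : ContDiffOn ℝ ∞ u₀ bc.space) (hbu₀ : bc.Holds u₀) :
    ∫ a in (0 : ℝ)..1, derivWithin u₀ bc.space a = 0 := by
  rw [integral_eq_sub_of_hasDerivWithinAt_space
    (fun x hx => ((hu₀.differentiableOn (by simp)) x hx).hasDerivWithinAt)
    (continuousOn_derivWithin_space hu₀), hbu₀.eq_zero_one, sub_self]

section Weighted

variable {bc : BdryKind} {w : ℝ → ℝ}

theorem continuousOn_exp_mul (hw : ContinuousOn w bc.space) (t : ℝ) :
    ContinuousOn (fun a => Real.exp (t * w a)) bc.space :=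
  Real.continuous_exp.comp_continuousOn (continuousOn_const.mul hw)

theorem intervalIntegrable_of_continuousOn_space {f : ℝ → ℝ} (hf : ContinuousOn f bc.space) :
    IntervalIntegrable f volume 0 1 := by
  refine (hf.mono ?_).intervalIntegrable
  rw [uIcc_of_le zero_le_one]
  exact bc.Icc_subset_space

/-- Integrate e^x ≥ 1 + x and use that w has mean zero. -/
theorem one_le_integral_exp_mul (hw : ContinuousOn w bc.space)
    (hw0 : ∫ a in (0 : ℝ)..1, w a = 0) (t : ℝ) :
    1 ≤ ∫ a in (0 : ℝ)..1, Real.exp (t * w a) := by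
  have hi := intervalIntegrable_of_continuousOn_space hw
  have h : ∫ a in (0 : ℝ)..1, (t * w a + 1) = 1 := by
    rw [intervalIntegral.integral_add (hi.const_mul t) intervalIntegrable_const]
    simp [hw0]
  refine h.symm.le.trans ?_
  exact intervalIntegral.integral_mono_on zero_le_one
    ((hi.const_mul t).add intervalIntegrable_const)
    (intervalIntegrable_of_continuousOn_space (continuousOn_exp_mul hw t))
    fun a _ => Real.add_one_le_exp _

theorem hasDerivAt_integral_exp_mul (hw : ContinuousOn w bc.space) (t : ℝ) :
    HasDerivAt (fun t => ∫ a in (0 : ℝ)..1, Real.exp (t * w a))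
      (∫ a in (0 : ℝ)..1, w a * Real.exp (t * w a)) t := by
  have hc : Continuous fun y => w (bc.retract y) := by
    rw [← continuousOn_univ]
    exact hw.comp bc.continuous_retract.continuousOn fun y _ => bc.retract_mem y
  have hc2 : Continuous fun q : ℝ × ℝ => w (bc.retract q.1) := hc.comp continuous_fst
  have he : Continuous fun q : ℝ × ℝ => Real.exp (q.2 * w (bc.retract q.1)) :=
    Real.continuous_exp.comp (continuous_snd.mul hc2)
  have h := hasDerivAt_integral_of_continuous (h := fun y t => Real.exp (t * w (bc.retract y)))
    (h' := fun y t => w (bc.retract y) * Real.exp (t * w (bc.retract y)))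
    he (hc2.mul he) (fun y t => by
      convert! ((hasDerivAt_id t).mul_const (w (bc.retract y))).exp using 1
      simp [mul_comm]) 0 1 t
  rw [integral_retract (h := fun y => w y * Real.exp (t * w y)) bc.zero_mem_space
    bc.one_mem_space] at h
  refine h.congr_of_eventuallyEq (Eventually.of_forall fun s => ?_)
  exact (integral_retract (h := fun y => Real.exp (s * w y)) bc.zero_mem_space
    bc.one_mem_space).symm

end Weighted

/-! ### Gradient, Jacobian and magnetic field along the flow of a solution -/

section Solution

variable {bc : BdryKind} {T : EReal} {u₀ b₀ : ℝ → ℝ} {u b p γ : ℝ → ℝ → ℝ}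

/-- The left side of the equation for `u_x` is the derivative along trajectories, and for λ = κ = 0
only the nonlocal term survives on the right. The rate is thus the same for every label. -/
theorem IsSolution.hasDerivWithinAt_partialX_flow (hs : IsSolution bc 0 0 T u₀ b₀ u b p)
    (hγ : IsFlow bc T u γ) {α t : ℝ} (hα : α ∈ bc.space) (ht : t ∈ timeIvl T) :
    HasDerivWithinAt (fun s => partialX bc u (γ α s) s) (nonlocalTerm bc 0 0 u b t)
      (timeIvl T) t := by
  have hT := uniqueDiffOn_timeIvl (pos_of_mem_timeIvl ht)
  have h : JointSmooth bc.space (timeIvl T) (partialX bc u) :=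
    JointSmooth.partial_fst hs.smooth_u bc.uniqueDiffOn_space hT
  have h1 := h.hasDerivWithinAt_curve bc.uniqueDiffOn_space hT (hγ.mem α hα) ht (hγ.ode α hα t ht)
  have h2 := hs.eq_ux _ (hγ.mem α hα t ht) t ht
  simp only [zero_mul, sub_zero, zero_add] at h2
  rw [← h2]
  exact h1

theorem IsSolution.magnetic_flow (hs : IsSolution bc 0 0 T u₀ b₀ u b p)
    (hγ : IsFlow bc T u γ) {α t : ℝ} (hα : α ∈ bc.space) (ht : t ∈ timeIvl T) :
    b (γ α t) t = b₀ α := by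
  have h0 := zero_mem_timeIvl_of_mem ht
  have hT := uniqueDiffOn_timeIvl (pos_of_mem_timeIvl ht)
  have := eq_of_hasDerivWithinAt_zero (convex_timeIvl T) (f := fun s => b (γ α s) s)
    (fun s hs' => by
      have h1 := JointSmooth.hasDerivWithinAt_curve (f := b) hs.smooth_b bc.uniqueDiffOn_space hT
        (hγ.mem α hα) hs' (hγ.ode α hα s hs')
      have h2 := hs.eq_b _ (hγ.mem α hα s hs') s hs'
      simp only [zero_mul] at h2
      rw [← h2]
      exact h1) ht h0
  simp only [hγ.init α hα, hs.init_b α hα] at this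
  exact this

theorem nonlocalTerm_zero_nonpos (bc : BdryKind) (u b : ℝ → ℝ → ℝ) (t : ℝ) :
    nonlocalTerm bc 0 0 u b t ≤ 0 := by
  have : 0 ≤ ∫ x in (0 : ℝ)..1, (partialX bc u x t) ^ 2 :=
    intervalIntegral.integral_nonneg zero_le_one fun x _ => sq_nonneg _
  simp only [nonlocalTerm]
  linarith

theorem IsSolution.partialX_zero (hs : IsSolution bc 0 0 T u₀ b₀ u b p) {α : ℝ}
    (hα : α ∈ bc.space) : partialX bc u α 0 = derivWithin u₀ bc.space α :=
  derivWithin_congr (fun x hx => hs.init_u x hx) (hs.init_u α hα)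

/-- The velocity gradient along trajectories differs from the initial one by a nonpositive
function of time only, and this function determines the Jacobian of the flow. -/
theorem IsSolution.exists_gradient_drift (hs : IsSolution bc 0 0 T u₀ b₀ u b p)
    (hγ : IsFlow bc T u γ) :
    ∃ F : ℝ → ℝ, ContinuousOn F (timeIvl T) ∧ (∀ t ∈ timeIvl T, F t ≤ 0) ∧
      ∀ α ∈ bc.space, ∀ t ∈ timeIvl T,
        partialX bc u (γ α t) t = derivWithin u₀ bc.space α + F t := by
  set W : ℝ → ℝ → ℝ := fun α t => partialX bc u (γ α t) t
  have h0 := bc.zero_mem_space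
  have hd : ∀ α ∈ bc.space, ∀ t ∈ timeIvl T,
      HasDerivWithinAt (W α) (nonlocalTerm bc 0 0 u b t) (timeIvl T) t :=
    fun α hα t ht => hs.hasDerivWithinAt_partialX_flow hγ hα ht
  have hW0 : ∀ α ∈ bc.space, W α 0 = derivWithin u₀ bc.space α := fun α hα => by
    simp only [W, hγ.init α hα, hs.partialX_zero hα]
  -- Label 0 serves as reference: all labels share the same rate of change, so its increment is the
  -- increment for every label.
  refine ⟨fun t => W 0 t - W 0 0, fun t ht => ((hd 0 h0 t ht).continuousWithinAt).sub
    continuousWithinAt_const, fun t ht => ?_, fun α hα t ht => ?_⟩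
  · have : AntitoneOn (W 0) (timeIvl T) := antitoneOn_of_hasDerivWithinAt_nonpos (convex_timeIvl T)
      (fun t ht => (hd 0 h0 t ht).continuousWithinAt)
      (fun t ht => (hd 0 h0 t (interior_subset ht)).mono interior_subset)
      fun t _ => nonlocalTerm_zero_nonpos bc u b t
    exact sub_nonpos.2 (this (zero_mem_timeIvl_of_mem ht) ht ht.1)
  · have := eq_of_hasDerivWithinAt_zero (convex_timeIvl T) (f := fun t => W α t - W 0 t)
      (fun t ht => by
        convert! (hd α hα t ht).sub (hd 0 h0 t ht) using 1
        rw [sub_self]) ht (zero_mem_timeIvl_of_mem ht)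
    rw [← hW0 α hα]
    show W α t = _
    linarith

theorem IsSolution.flow_formulas (hs : IsSolution bc 0 0 T u₀ b₀ u b p)
    (hu₀ : ContDiffOn ℝ ∞ u₀ bc.space) (hbu₀ : bc.Holds u₀)
    (hγ : IsFlow bc T u γ) {α t : ℝ} (hα : α ∈ bc.space) (ht : t ∈ timeIvl T) :
    Real.exp (∫ s in (0 : ℝ)..t, partialX bc u (γ α s) s)
        = Real.exp (t * derivWithin u₀ bc.space α)
          * (∫ a in (0 : ℝ)..1, Real.exp (t * derivWithin u₀ bc.space a))⁻¹ ∧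
      0 ≤ derivWithin u₀ bc.space α - partialX bc u (γ α t) t ∧
      derivWithin u₀ bc.space α - partialX bc u (γ α t) t
        ≤ ∫ a in (0 : ℝ)..1,
            derivWithin u₀ bc.space a * Real.exp (t * derivWithin u₀ bc.space a) := by
  obtain ⟨F, hFc, hF0, hF⟩ := hs.exists_gradient_drift hγ
  set w : ℝ → ℝ := derivWithin u₀ bc.space with hw_def
  have hw : ContinuousOn w bc.space := continuousOn_derivWithin_space hu₀
  have hw0 : ∫ a in (0 : ℝ)..1, w a = 0 := integral_derivWithin_eq_zero hu₀ hbu₀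
  set M : ℝ → ℝ := fun t => ∫ a in (0 : ℝ)..1, Real.exp (t * w a)
  have hM1 : ∀ t, 1 ≤ M t := one_le_integral_exp_mul hw hw0
  have hexp : ∀ α ∈ bc.space, ∀ t ∈ timeIvl T,
      Real.exp (∫ s in (0 : ℝ)..t, partialX bc u (γ α s) s)
        = Real.exp (t * w α) * Real.exp (∫ s in (0 : ℝ)..t, F s) := by
    intro α hα t ht
    rw [← Real.exp_add]
    congr 1
    have hi : IntervalIntegrable F volume 0 t := by
      refine (hFc.mono ?_).intervalIntegrable
      rw [uIcc_of_le ht.1]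
      exact Icc_subset_timeIvl ht
    rw [intervalIntegral.integral_congr (g := fun s => w α + F s) fun s hs' => ?_,
      intervalIntegral.integral_add intervalIntegrable_const hi]
    · simp
    · rw [uIcc_of_le ht.1] at hs'
      exact hF α hα s (Icc_subset_timeIvl ht hs')
  -- The integral of the Jacobian over [0,1] is γ(1,t) - γ(0,t) = 1.
  have hMJ : ∀ t ∈ timeIvl T, M t * Real.exp (∫ s in (0 : ℝ)..t, F s) = 1 := by
    intro t ht
    have h1 := integral_eq_sub_of_hasDerivWithinAt_space (bc := bc) (f := fun a => γ a t)
      (f' := fun a => Real.exp (t * w a) * Real.exp (∫ s in (0 : ℝ)..t, F s))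
      (fun a ha => by
        rw [← hexp a ha t ht]
        exact hγ.hasDerivWithinAt_exp_integral hs.smooth_u hs.bdry_u ha ht)
      ((continuousOn_exp_mul hw t).mul continuousOn_const)
    rw [intervalIntegral.integral_mul_const, hγ.one_eq hs.smooth_u hs.bdry_u ht] at h1
    linarith
  -- Differentiate the identity M e^{∫F} = 1. A time τ beyond t gives a nondegenerate interval, on
  -- which derivatives are unique even when t = 0.
  have hFM : M t * F t = - ∫ a in (0 : ℝ)..1, w a * Real.exp (t * w a) := by
    obtain ⟨τ, hτ, htτ⟩ := exists_gt_mem_timeIvl ht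
    have hsub := Icc_subset_timeIvl hτ
    have htm : t ∈ Icc 0 τ := ⟨ht.1, htτ.le⟩
    have h1 := (hasDerivAt_integral_exp_mul hw t).hasDerivWithinAt (s := Icc 0 τ) |>.mul
      (hasDerivWithinAt_primitive_Icc (hFc.mono hsub) htm).exp
    have h2 : HasDerivWithinAt (fun _ => (1 : ℝ)) 0 (Icc 0 τ) t := hasDerivWithinAt_const _ _ _
    have h3 := (uniqueDiffOn_Icc (ht.1.trans_lt htτ) t htm).eq_deriv _
      (h1.congr_of_mem (fun s hs' => (hMJ s (hsub hs')).symm) htm) h2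
    have hpos := Real.exp_pos (∫ s in (0 : ℝ)..t, F s)
    have h4 : Real.exp (∫ s in (0 : ℝ)..t, F s) *
        ((∫ a in (0 : ℝ)..1, w a * Real.exp (t * w a)) + M t * F t) = 0 := by
      linear_combination h3
    have := (mul_eq_zero.1 h4).resolve_left hpos.ne'
    linarith
  refine ⟨?_, ?_, ?_⟩
  · rw [hexp α hα t ht]
    congr 1
    exact eq_inv_of_mul_eq_one_right (hMJ t ht)
  · rw [hF α hα t ht]
    linarith [hF0 t ht]
  · rw [hF α hα t ht]
    -- Since F ≤ 0 and M ≥ 1, -F ≤ -MF = ∫w e^{tw}.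
    nlinarith [hF0 t ht, hM1 t]

end Solution

/-! ### Uniqueness -/

theorem integral_comp_mul_deriv_space {bc : BdryKind} {φ φ' g : ℝ → ℝ}
    (hφ : ∀ x ∈ bc.space, HasDerivWithinAt φ (φ' x) bc.space x) (hφ' : ContinuousOn φ' bc.space)
    (hm : MapsTo φ bc.space bc.space) (hg : ContinuousOn g bc.space) :
    ∫ a in (0 : ℝ)..1, g (φ a) * φ' a = ∫ x in (φ 0)..(φ 1), g x := by
  have hsub := bc.Icc_subset_space
  have hu : uIcc (0 : ℝ) 1 = Icc 0 1 := uIcc_of_le zero_le_one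
  refine intervalIntegral.integral_comp_mul_deriv'' (f := φ) (f' := φ') (g := g) ?_ ?_ ?_ ?_
  · rw [hu]
    exact fun x hx => ((hφ x (hsub hx)).mono hsub).continuousWithinAt
  · intro x hx
    simp only [zero_le_one, inf_of_le_left, sup_of_le_right] at hx
    exact (((hφ x (hsub (Ioo_subset_Icc_self hx))).mono hsub).hasDerivAt
      (Icc_mem_nhds hx.1 hx.2)).hasDerivWithinAt
  · rw [hu]
    exact hφ'.mono hsub
  · rw [hu]
    exact hg.mono (hm.mono_left hsub).image_subset

theorem BdryKind.surjOn_space (bc : BdryKind) {f : ℝ → ℝ} (hf : ContinuousOn f bc.space)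
    (hd : bc = .dirichlet → f 0 = 0 ∧ f 1 = 1) (hp : bc = .periodic → ∀ n : ℤ, f n = f 0 + n) :
    SurjOn f bc.space bc.space := by
  cases bc with
  | dirichlet =>
    have h : Icc (f 0) (f 1) ⊆ _ := intermediate_value_Icc zero_le_one hf
    rwa [(hd rfl).1, (hd rfl).2] at h
  | periodic =>
    intro x _
    set n := ⌊x - f 0⌋
    have h1 := hp rfl n
    have h2 := hp rfl (n + 1)
    push_cast at h2
    have h : Icc (f n) (f (n + 1)) ⊆ _ := intermediate_value_Icc
      (by linarith : (n : ℝ) ≤ n + 1) (hf.mono (subset_univ _))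
    rw [h1, h2] at h
    obtain ⟨a, _, ha⟩ := @h x ⟨by linarith [Int.floor_le (x - f 0)],
      by linarith [Int.lt_floor_add_one (x - f 0)]⟩
    exact ⟨a, mem_univ _, ha⟩

section Uniqueness

variable {bc : BdryKind} {T : EReal} {u₀ b₀ : ℝ → ℝ} {u b p γ v c q η : ℝ → ℝ → ℝ}

theorem IsFlow.periodic_add_int (hγ : IsFlow .periodic T u γ)
    (hu : JointSmooth BdryKind.periodic.space (timeIvl T) u)
    (hb : ∀ t ∈ timeIvl T, BdryKind.periodic.Holds fun x => u x t) (n : ℤ) {t : ℝ}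
    (ht : t ∈ timeIvl T) : γ n t = γ 0 t + n := by
  have := hγ.eq_of_trajectory hu hb (c := fun t => γ 0 t + n) (fun t ht => by
    have h : u (γ 0 t + n) t = u (γ 0 t) t := by
      have h1 : Function.Periodic (fun x => u x t) 1 := hb t ht
      simpa using h1.int_mul n (γ 0 t)
    rw [h]
    exact (hγ.ode 0 (mem_univ _) t ht).add_const _) (fun _ _ => mem_univ _) ht
  rwa [hγ.init 0 (mem_univ _), zero_add] at this

theorem IsFlow.surjOn (hγ : IsFlow bc T u γ) (hu : JointSmooth bc.space (timeIvl T) u)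
    (hb : ∀ t ∈ timeIvl T, bc.Holds fun x => u x t) {t : ℝ} (ht : t ∈ timeIvl T) :
    SurjOn (fun a => γ a t) bc.space bc.space := by
  refine bc.surjOn_space (fun a ha =>
    (hγ.hasDerivWithinAt_exp_integral hu hb ha ht).continuousWithinAt) ?_ ?_
  · rintro rfl
    exact ⟨hγ.dirichlet_zero hu hb ht, hγ.dirichlet_one hu hb ht⟩
  · rintro rfl n
    exact hγ.periodic_add_int hu hb n ht

/-- The mean velocity is conserved when the pressure is equal at the two ends of the period. -/
theorem IsSolution.integral_eq_of_pressure (hs : IsSolution bc 0 0 T u₀ b₀ u b p)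
    (hp : ∀ t ∈ timeIvl T, p 0 t = p 1 t) {t : ℝ} (ht : t ∈ timeIvl T) :
    ∫ x in (0 : ℝ)..1, u x t = ∫ x in (0 : ℝ)..1, u₀ x := by
  have hsub := Icc_subset_timeIvl ht
  have hT := uniqueDiffOn_timeIvl (pos_of_mem_timeIvl ht)
  have hu : JointSmooth bc.space (timeIvl T) u := hs.smooth_u
  have hb : JointSmooth bc.space (timeIvl T) b := hs.smooth_b
  have hpr : JointSmooth bc.space (timeIvl T) p := hs.smooth_p
  have hut : JointSmooth bc.space (timeIvl T) (partialT T u) :=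
    hu.partial_snd bc.uniqueDiffOn_space hT
  -- By the momentum equation u_t is the x-derivative of b²/2 - p - u²/2, which takes equal values
  -- at 0 and 1.
  have hflux : ∀ s ∈ timeIvl T, ∫ x in (0 : ℝ)..1, partialT T u x s = 0 := by
    intro s hs'
    rw [integral_eq_sub_of_hasDerivWithinAt_space (bc := bc)
      (f := fun x => b x s ^ 2 / 2 - p x s - u x s ^ 2 / 2) (fun x hx => ?_)
      (hut.contDiffOn_fst hs').continuousOn]
    · have h1 : u 1 s = u 0 s := (hs.bdry_u s hs').eq_zero_one
      have h2 : b 1 s = b 0 s := (hs.bdry_b s hs').eq_zero_one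
      rw [h1, h2, hp s hs']
      ring
    · have hu1 := hu.hasDerivWithinAt_fst hx hs'
      have hb1 := hb.hasDerivWithinAt_fst hx hs'
      have hp1 := hpr.hasDerivWithinAt_fst hx hs'
      convert! (((hb1.pow 2).div_const 2).sub hp1).sub ((hu1.pow 2).div_const 2) using 1
      have := hs.eq_u x hx s hs'
      simp only [partialX] at this
      push_cast
      linear_combination this
  have hftc : ∀ x ∈ bc.space, u x t - u₀ x = ∫ s in (0 : ℝ)..t, partialT T u x s := by
    intro x hx
    rw [← hs.init_u x hx]
    refine (intervalIntegral.integral_eq_sub_of_hasDerivAt_of_le ht.1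
      ((hu.contDiffOn_snd hx).continuousOn.mono hsub) (fun s hs' => ?_) ?_).symm
    · exact ((hu.hasDerivWithinAt_snd hx (hsub (Ioo_subset_Icc_self hs'))).mono hsub).hasDerivAt
        (Icc_mem_nhds hs'.1 hs'.2)
    · refine ((hut.contDiffOn_snd hx).continuousOn.mono ?_).intervalIntegrable
      rwa [uIcc_of_le ht.1]
  have hu₀ : ContinuousOn u₀ bc.space :=
    (hu.contDiffOn_fst (zero_mem_timeIvl_of_mem ht)).continuousOn.congr
      fun x hx => (hs.init_u x hx).symm
  rw [← sub_eq_zero, ← intervalIntegral.integral_sub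
    (intervalIntegrable_of_continuousOn_space (hu.contDiffOn_fst ht).continuousOn)
    (intervalIntegrable_of_continuousOn_space hu₀)]
  rw [intervalIntegral.integral_congr (g := fun x => ∫ s in (0 : ℝ)..t, partialT T u x s)
    fun x hx => ?_, intervalIntegral_intervalIntegral_swap]
  · rw [intervalIntegral.integral_congr (g := fun _ => 0) fun s hs' => ?_]
    · simp
    · rw [uIcc_of_le ht.1] at hs'
      exact hflux s (hsub hs')
  · have hcpt : IsCompact (Icc (0 : ℝ) 1 ×ˢ Icc (0 : ℝ) t) := isCompact_Icc.prod isCompact_Icc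
    refine ((hut.continuousOn.mono (prod_mono bc.Icc_subset_space hsub)).integrableOn_compact
      hcpt).mono_set (prod_mono ?_ ?_)
    · rw [uIoc_of_le zero_le_one]
      exact Ioc_subset_Icc_self
    · rw [uIoc_of_le ht.1]
      exact Ioc_subset_Icc_self
  · rw [uIcc_of_le zero_le_one] at hx
    exact hftc x (bc.Icc_subset_space hx)

/-- Both flows have the Jacobian determined by u₀, so their difference has zero derivative in the
label. -/
theorem IsSolution.flow_sub_eq (hs : IsSolution bc 0 0 T u₀ b₀ u b p)
    (hs' : IsSolution bc 0 0 T u₀ b₀ v c q) (hu₀ : ContDiffOn ℝ ∞ u₀ bc.space)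
    (hbu₀ : bc.Holds u₀) (hγ : IsFlow bc T u γ) (hη : IsFlow bc T v η) {α t : ℝ}
    (hα : α ∈ bc.space) (ht : t ∈ timeIvl T) : γ α t - η α t = γ 0 t - η 0 t := by
  refine eq_of_hasDerivWithinAt_zero bc.convex_space (f := fun a => γ a t - η a t)
    (fun a ha => ?_) hα bc.zero_mem_space
  have h1 := hγ.hasDerivWithinAt_exp_integral hs.smooth_u hs.bdry_u ha ht
  have h2 := hη.hasDerivWithinAt_exp_integral hs'.smooth_u hs'.bdry_u ha ht
  rw [(hs.flow_formulas hu₀ hbu₀ hγ ha ht).1] at h1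
  rw [(hs'.flow_formulas hu₀ hbu₀ hη ha ht).1] at h2
  convert! h1.sub h2 using 1
  rw [sub_self]

/-- The conserved mean of `u`, written in Lagrangian labels by the substitution x = γ(a,t). The
weight is the same for all solutions with the same data. -/
theorem IsSolution.integral_velocity_flow (hs : IsSolution .periodic 0 0 T u₀ b₀ u b p)
    (hu₀ : ContDiffOn ℝ ∞ u₀ BdryKind.periodic.space) (hbu₀ : BdryKind.periodic.Holds u₀)
    (hp : ∀ t ∈ timeIvl T, p 0 t = p 1 t)
    (hγ : IsFlow .periodic T u γ) {t : ℝ} (ht : t ∈ timeIvl T) :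
    ∫ a in (0 : ℝ)..1, u (γ a t) t * (Real.exp (t * derivWithin u₀ BdryKind.periodic.space a) *
      (∫ a in (0 : ℝ)..1, Real.exp (t * derivWithin u₀ BdryKind.periodic.space a))⁻¹) =
      ∫ x in (0 : ℝ)..1, u₀ x := by
  have hu : JointSmooth BdryKind.periodic.space (timeIvl T) u := hs.smooth_u
  rw [integral_comp_mul_deriv_space (φ := fun a => γ a t) (g := fun x => u x t)
    (fun a ha => ?_) ?_ (fun a ha => hγ.mem a ha t ht) (hu.contDiffOn_fst ht).continuousOn]
  · have hper : Function.Periodic (fun x => u x t) 1 := hs.bdry_u t ht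
    rw [hγ.one_eq hs.smooth_u hs.bdry_u ht, hper.intervalIntegral_add_eq _ 0, zero_add,
      hs.integral_eq_of_pressure hp ht]
  · exact (continuousOn_exp_mul (continuousOn_derivWithin_space hu₀) t).mul continuousOn_const
  · rw [← (hs.flow_formulas hu₀ hbu₀ hγ ha ht).1]
    exact hγ.hasDerivWithinAt_exp_integral hs.smooth_u hs.bdry_u ha ht

theorem integral_jacobian_eq_one (hu₀ : ContDiffOn ℝ ∞ u₀ bc.space) (hbu₀ : bc.Holds u₀) (t : ℝ) :
    ∫ a in (0 : ℝ)..1, (Real.exp (t * derivWithin u₀ bc.space a) *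
      (∫ a in (0 : ℝ)..1, Real.exp (t * derivWithin u₀ bc.space a))⁻¹) = 1 := by
  have := one_le_integral_exp_mul (continuousOn_derivWithin_space hu₀)
    (integral_derivWithin_eq_zero hu₀ hbu₀) t
  rw [intervalIntegral.integral_mul_const, mul_inv_cancel₀ (by linarith)]

/-- Only a translation in time remains between the two flows. It vanishes at a wall, and in the
periodic setting its speed is zero because the two conserved means agree. -/
theorem IsSolution.flow_eq (hs : IsSolution bc 0 0 T u₀ b₀ u b p)
    (hs' : IsSolution bc 0 0 T u₀ b₀ v c q) (hu₀ : ContDiffOn ℝ ∞ u₀ bc.space)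
    (hbu₀ : bc.Holds u₀) (hp : bc = .periodic → ∀ t ∈ timeIvl T, p 0 t = p 1 t)
    (hq : bc = .periodic → ∀ t ∈ timeIvl T, q 0 t = q 1 t)
    (hγ : IsFlow bc T u γ) (hη : IsFlow bc T v η) {α t : ℝ}
    (hα : α ∈ bc.space) (ht : t ∈ timeIvl T) : γ α t = η α t := by
  rw [← sub_eq_zero, hs.flow_sub_eq hs' hu₀ hbu₀ hγ hη hα ht]
  cases bc with
  | dirichlet =>
    rw [hγ.dirichlet_zero hs.smooth_u hs.bdry_u ht, hη.dirichlet_zero hs'.smooth_u hs'.bdry_u ht,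
      sub_self]
  | periodic =>
    have hd : ∀ s ∈ timeIvl T, u (γ 0 s) s - v (η 0 s) s = 0 := by
      intro s hst
      have hT := uniqueDiffOn_timeIvl (pos_of_mem_timeIvl hst)
      -- Differentiating `IsSolution.flow_sub_eq` in time: the velocities at equal labels differ by
      -- a number independent of the label. Integrated against the common Jacobian, of mass 1, that
      -- number is the difference of the means.
      have hconst : ∀ a, u (γ a s) s = v (η a s) s + (u (γ 0 s) s - v (η 0 s) s) := by
        intro a
        have h1 := (hγ.ode a (mem_univ _) s hst).sub (hη.ode a (mem_univ _) s hst)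
        have h2 := (hγ.ode 0 (mem_univ _) s hst).sub (hη.ode 0 (mem_univ _) s hst)
        have h3 := (hT s hst).eq_deriv _ (h1.congr_of_mem (fun r hr =>
          (hs.flow_sub_eq hs' hu₀ hbu₀ hγ hη (mem_univ a) hr).symm) hst) h2
        linarith
      have h1 := hs.integral_velocity_flow hu₀ hbu₀ (hp rfl) hγ hst
      have h2 := hs'.integral_velocity_flow hu₀ hbu₀ (hq rfl) hη hst
      have hJ := integral_jacobian_eq_one (bc := .periodic) hu₀ hbu₀ s
      have hJc : ContinuousOn (fun a => Real.exp (s * derivWithin u₀ BdryKind.periodic.space a) *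
          (∫ a in (0 : ℝ)..1, Real.exp (s * derivWithin u₀ BdryKind.periodic.space a))⁻¹)
          BdryKind.periodic.space :=
        (continuousOn_exp_mul (continuousOn_derivWithin_space hu₀) s).mul continuousOn_const
      have hv : JointSmooth BdryKind.periodic.space (timeIvl T) v := hs'.smooth_u
      have hvc : ContinuousOn (fun a => v (η a s) s) BdryKind.periodic.space :=
        (hv.contDiffOn_fst hst).continuousOn.comp (fun a ha =>
          (hη.hasDerivWithinAt_exp_integral hv hs'.bdry_u ha hst).continuousWithinAt)
          fun _ _ => mem_univ _
      generalize hJ_def : (fun a => Real.exp (s * derivWithin u₀ BdryKind.periodic.space a) *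
          (∫ a in (0 : ℝ)..1, Real.exp (s * derivWithin u₀ BdryKind.periodic.space a))⁻¹) = J at *
      have hJa := fun a => congrFun hJ_def a
      beta_reduce at hJa
      simp only [hJa] at h1 h2 hJ
      have hi1 : IntervalIntegrable (fun a => v (η a s) s * J a) volume 0 1 :=
        intervalIntegrable_of_continuousOn_space (hvc.mul hJc)
      have hi2 : IntervalIntegrable (fun a => (u (γ 0 s) s - v (η 0 s) s) * J a) volume 0 1 :=
        (intervalIntegrable_of_continuousOn_space hJc).const_mul _
      rw [intervalIntegral.integral_congr (fun a _ => by rw [hconst a, add_mul]),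
        intervalIntegral.integral_add hi1 hi2, h2, intervalIntegral.integral_const_mul, hJ] at h1
      linarith
    have := eq_of_hasDerivWithinAt_zero (convex_timeIvl T) (f := fun s => γ 0 s - η 0 s)
      (fun s hst => by
        have := (hγ.ode 0 (mem_univ _) s hst).sub (hη.ode 0 (mem_univ _) s hst)
        rwa [hd s hst] at this) ht
      (zero_mem_timeIvl_of_mem ht)
    simpa [hγ.init 0 (mem_univ _), hη.init 0 (mem_univ _)] using this

/-- Smooth solutions, with equal pressure at the two ends of the period in the periodic setting,
are unique. -/
theorem IsSolution.unique (hs : IsSolution bc 0 0 T u₀ b₀ u b p)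
    (hs' : IsSolution bc 0 0 T u₀ b₀ v c q) (hu₀ : ContDiffOn ℝ ∞ u₀ bc.space)
    (hbu₀ : bc.Holds u₀) (hp : bc = .periodic → ∀ t ∈ timeIvl T, p 0 t = p 1 t)
    (hq : bc = .periodic → ∀ t ∈ timeIvl T, q 0 t = q 1 t) {x t : ℝ} (hx : x ∈ bc.space)
    (ht : t ∈ timeIvl T) : u x t = v x t ∧ b x t = c x t := by
  have hT := pos_of_mem_timeIvl ht
  obtain ⟨γ, hγ⟩ := exists_isFlow hs.smooth_u hs.bdry_u hT
  obtain ⟨η, hη⟩ := exists_isFlow hs'.smooth_u hs'.bdry_u hT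
  have heq : ∀ α ∈ bc.space, ∀ s ∈ timeIvl T, γ α s = η α s := fun α hα s hst =>
    hs.flow_eq hs' hu₀ hbu₀ hp hq hγ hη hα hst
  -- Every point lies on a trajectory, where `u` is the time derivative of the common flow and `b`
  -- is b₀ at the label.
  obtain ⟨α, hα, rfl⟩ := hγ.surjOn hs.smooth_u hs.bdry_u ht hx
  have h1 := hγ.ode α hα t ht
  have h2 := (hη.ode α hα t ht).congr_of_mem (fun s hst => heq α hα s hst) ht
  simp only
  constructor
  · rw [(uniqueDiffOn_timeIvl hT t ht).eq_deriv _ h1 h2, heq α hα t ht]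
  · rw [hs.magnetic_flow hγ hα ht, heq α hα t ht, hs'.magnetic_flow hη hα ht]

end Uniqueness

/-! ### Smoothness of the inverse of a family of diffeomorphisms -/

namespace JointSmooth

variable {A : Set ℝ} {f : ℝ → ℝ → ℝ}

theorem deriv_snd (hf : JointSmooth A univ f) (hA : UniqueDiffOn ℝ A) :
    JointSmooth A univ fun x t => deriv (f x) t := by
  simpa only [derivWithin_univ] using hf.partial_snd hA uniqueDiffOn_univ

theorem hasDerivAt_snd (hf : JointSmooth A univ f) {x : ℝ} (hx : x ∈ A) (t : ℝ) :
    HasDerivAt (f x) (deriv (f x) t) t := by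
  have := hf.hasDerivWithinAt_snd hx (mem_univ t)
  rwa [derivWithin_univ, hasDerivWithinAt_univ] at this

theorem hasDerivAt_curve (hf : JointSmooth A univ f) (hA : UniqueDiffOn ℝ A) {c : ℝ → ℝ}
    {c' t : ℝ} (hc : ∀ s, c s ∈ A) (h : HasDerivAt c c' t) :
    HasDerivAt (fun s => f (c s) s)
      (deriv (f (c t)) t + c' * derivWithin (fun y => f y t) A (c t)) t := by
  have := hf.hasDerivWithinAt_curve hA uniqueDiffOn_univ (fun s _ => hc s) (mem_univ t)
    h.hasDerivWithinAt
  rwa [derivWithin_univ, hasDerivWithinAt_univ] at this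

end JointSmooth

theorem mul_abs_sub_le_of_le_derivWithin {S : Set ℝ} (hS : Convex ℝ S) {f f' : ℝ → ℝ} {m : ℝ}
    (hf : ∀ x ∈ S, HasDerivWithinAt f (f' x) S x) (hm : ∀ x ∈ S, m ≤ f' x)
    {x y : ℝ} (hx : x ∈ S) (hy : y ∈ S) : m * |x - y| ≤ |f x - f y| := by
  have key : ∀ x ∈ S, ∀ y ∈ S, x ≤ y → m * (y - x) ≤ f y - f x := by
    have hd : ∀ x ∈ interior S, HasDerivAt f (f' x) x := fun x hx =>
      (hf x (interior_subset hx)).hasDerivAt (mem_interior_iff_mem_nhds.1 hx)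
    exact hS.mul_sub_le_image_sub_of_le_deriv (fun x hx => (hf x hx).continuousWithinAt)
      (fun x hx => (hd x hx).differentiableAt.differentiableWithinAt)
      (fun x hx => by rw [(hd x hx).deriv]; exact hm x (interior_subset hx))
  rcases le_total x y with h | h
  · rw [abs_sub_comm x, abs_sub_comm (f x), abs_of_nonneg (sub_nonneg.2 h)]
    exact (key x hx y hy h).trans (le_abs_self _)
  · rw [abs_of_nonneg (sub_nonneg.2 h)]
    exact (key y hy x hx h).trans (le_abs_self _)

section Inverse

variable {bc : BdryKind} {G A : ℝ → ℝ → ℝ} {m : ℝ → ℝ}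

/-- The lower bound on the slope gives m(t)|A(x,t) - A(x₀,t₀)| ≤ |x - G(A(x₀,t₀),t)|. The right side
tends to 0, and m is continuous and positive. -/
theorem continuousOn_inverse (hG : JointSmooth bc.space univ G)
    (hA : ∀ x ∈ bc.space, ∀ t, A x t ∈ bc.space) (hGA : ∀ x ∈ bc.space, ∀ t, G (A x t) t = x)
    (hm : Continuous m) (hm0 : ∀ t, 0 < m t)
    (hlow : ∀ a ∈ bc.space, ∀ t, m t ≤ derivWithin (fun y => G y t) bc.space a) :
    ContinuousOn (fun q : ℝ × ℝ => A q.1 q.2) (bc.space ×ˢ univ) := by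
  rintro ⟨x₀, t₀⟩ ⟨hx₀, -⟩
  have hGc : Continuous fun t => G (A x₀ t₀) t := by
    rw [← continuousOn_univ]
    exact (hG.contDiffOn_snd (hA x₀ hx₀ t₀)).continuousOn
  have hlim : Continuous fun q : ℝ × ℝ => |q.1 - G (A x₀ t₀) q.2| / m q.2 :=
    Continuous.div (by fun_prop) (by fun_prop) fun q => (hm0 q.2).ne'
  have h0 := (hlim.tendsto (x₀, t₀)).mono_left (nhdsWithin_le_nhds (s := bc.space ×ˢ univ))
  simp only [hGA x₀ hx₀, sub_self, abs_zero, zero_div] at h0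
  unfold ContinuousWithinAt
  rw [tendsto_iff_dist_tendsto_zero]
  refine squeeze_zero' (Eventually.of_forall fun _ => dist_nonneg) ?_ h0
  filter_upwards [self_mem_nhdsWithin] with q hq
  rw [le_div_iff₀ (hm0 _), mul_comm, Real.dist_eq]
  have := mul_abs_sub_le_of_le_derivWithin bc.convex_space
    (fun y hy => hG.hasDerivWithinAt_fst hy (mem_univ q.2)) (fun y hy => hlow y hy q.2)
    (hA q.1 hq.1 q.2) (hA x₀ hx₀ t₀)
  rwa [hGA q.1 hq.1] at this

/-- The map (x,t) ↦ (A,t) is inverse to (a,t) ↦ (G,t), whose differential is triangular with nonzero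
entry ∂G/∂a. A continuous inverse of a map with invertible differential is differentiable. -/
theorem hasFDerivWithinAt_inverse (hG : JointSmooth bc.space univ G)
    (hA : ∀ x ∈ bc.space, ∀ t, A x t ∈ bc.space) (hGA : ∀ x ∈ bc.space, ∀ t, G (A x t) t = x)
    (hAc : ContinuousOn (fun q : ℝ × ℝ => A q.1 q.2) (bc.space ×ˢ univ))
    (hpos : ∀ a ∈ bc.space, ∀ t, 0 < derivWithin (fun y => G y t) bc.space a)
    {q : ℝ × ℝ} (hq : q ∈ bc.space ×ˢ (univ : Set ℝ)) :
    HasFDerivWithinAt (fun q : ℝ × ℝ => A q.1 q.2)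
      ((derivWithin (fun y => G y q.2) bc.space (A q.1 q.2))⁻¹ •
        (ContinuousLinearMap.fst ℝ ℝ ℝ -
          deriv (G (A q.1 q.2)) q.2 • ContinuousLinearMap.snd ℝ ℝ ℝ))
      (bc.space ×ˢ univ) q := by
  have ha := hA q.1 hq.1 q.2
  set L := fderivWithin ℝ (fun q : ℝ × ℝ => G q.1 q.2) (bc.space ×ˢ univ) (A q.1 q.2, q.2)
  have hL : HasFDerivWithinAt (fun q : ℝ × ℝ => G q.1 q.2) L (bc.space ×ˢ univ)
      (A q.1 q.2, q.2) := hG.hasFDerivWithinAt ha (mem_univ _)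
  have hLx : derivWithin (fun y => G y q.2) bc.space (A q.1 q.2) = L (1, 0) :=
    hG.derivWithin_fst bc.uniqueDiffOn_space ha (mem_univ _)
  have hLt : deriv (G (A q.1 q.2)) q.2 = L (0, 1) := by
    rw [← derivWithin_univ]
    exact hG.derivWithin_snd uniqueDiffOn_univ ha (mem_univ _)
  have hLx0 : L (1, 0) ≠ 0 := hLx ▸ (hpos _ ha _).ne'
  rw [hLx, hLt]
  set R : ℝ × ℝ →L[ℝ] ℝ := (L (1, 0))⁻¹ • (ContinuousLinearMap.fst ℝ ℝ ℝ -
    L (0, 1) • ContinuousLinearMap.snd ℝ ℝ ℝ)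
  have hΦ : HasFDerivWithinAt (fun q : ℝ × ℝ => (G q.1 q.2, q.2))
      (L.prod (ContinuousLinearMap.snd ℝ ℝ ℝ)) (bc.space ×ˢ univ) (A q.1 q.2, q.2) :=
    hL.prodMk hasFDerivWithinAt_snd
  have hΨc : Tendsto (fun q : ℝ × ℝ => (A q.1 q.2, q.2)) (𝓝[bc.space ×ˢ univ] q)
      (𝓝[bc.space ×ˢ univ] (A q.1 q.2, q.2)) := by
    rw [tendsto_nhdsWithin_iff]
    refine ⟨(hAc q hq).prodMk_nhds (continuous_snd.continuousAt.mono_left nhdsWithin_le_nhds), ?_⟩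
    filter_upwards [self_mem_nhdsWithin] with r hr
    exact ⟨hA r.1 hr.1 r.2, mem_univ _⟩
  have hsymm : ∀ v : ℝ × ℝ,
      (R.prod (ContinuousLinearMap.snd ℝ ℝ ℝ)) ((L.prod (ContinuousLinearMap.snd ℝ ℝ ℝ)) v) = v := by
    rintro ⟨v₁, v₂⟩
    have e : ((v₁, v₂) : ℝ × ℝ) = v₁ • (1, 0) + v₂ • (0, 1) := by simp
    have hLv : L (v₁, v₂) = v₁ * L (1, 0) + v₂ * L (0, 1) := by
      rw [e, map_add, map_smul, map_smul, smul_eq_mul, smul_eq_mul]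
    simp only [ContinuousLinearMap.prod_apply, ContinuousLinearMap.coe_snd', R,
      smul_apply, sub_apply, ContinuousLinearMap.coe_fst',
      smul_eq_mul, hLv, Prod.mk.injEq, and_true]
    field_simp
    ring
  have := HasFDerivWithinAt.of_comp_of_leftInverse
    (g := fun q : ℝ × ℝ => (A q.1 q.2, q.2)) (a := q) hΨc hΦ (hasFDerivWithinAt_id _ _)
    (by
      filter_upwards [self_mem_nhdsWithin] with r hr
      exact Prod.ext (hGA r.1 hr.1 r.2) rfl) hsymm hq
  have h1 := (hasFDerivAt_fst (𝕜 := ℝ) (E := ℝ) (F := ℝ)).comp_hasFDerivWithinAt q this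
  refine h1.congr_fderiv ?_
  ext <;> simp

/-- The inverses of a smooth family of one-dimensional diffeomorphisms form a smooth family. -/
theorem JointSmooth.inverse (hG : JointSmooth bc.space univ G)
    (hA : ∀ x ∈ bc.space, ∀ t, A x t ∈ bc.space) (hGA : ∀ x ∈ bc.space, ∀ t, G (A x t) t = x)
    (hm : Continuous m) (hm0 : ∀ t, 0 < m t)
    (hlow : ∀ a ∈ bc.space, ∀ t, m t ≤ derivWithin (fun y => G y t) bc.space a) :
    JointSmooth bc.space univ A := by
  have hAc := continuousOn_inverse hG hA hGA hm hm0 hlow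
  have hpos : ∀ a ∈ bc.space, ∀ t, 0 < derivWithin (fun y => G y t) bc.space a :=
    fun a ha t => (hm0 t).trans_le (hlow a ha t)
  have hU : UniqueDiffOn ℝ (bc.space ×ˢ (univ : Set ℝ)) :=
    bc.uniqueDiffOn_space.prod uniqueDiffOn_univ
  refine contDiffOn_infty.2 fun n => ?_
  induction n with
  | zero => rwa [Nat.cast_zero, contDiffOn_zero]
  | succ n ih =>
    -- Bootstrap: the differential of A is built from derivatives of the smooth G evaluated at
    -- (A,t), so it is as regular as A, which raises the order by one.
    have hΨ : ContDiffOn ℝ n (fun q : ℝ × ℝ => (A q.1 q.2, q.2)) (bc.space ×ˢ univ) :=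
      ih.prodMk _root_.contDiffOn_snd
    have hmaps : MapsTo (fun q : ℝ × ℝ => (A q.1 q.2, q.2)) (bc.space ×ˢ (univ : Set ℝ))
        (bc.space ×ˢ (univ : Set ℝ)) := fun q hq => ⟨hA q.1 hq.1 q.2, mem_univ _⟩
    have hx : ContDiffOn ℝ n
        (fun q : ℝ × ℝ => derivWithin (fun y => G y q.2) bc.space (A q.1 q.2))
        (bc.space ×ˢ univ) :=
      (ContDiffOn.of_le (hG.partial_fst bc.uniqueDiffOn_space uniqueDiffOn_univ)
        (by exact_mod_cast le_top)).comp hΨ hmaps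
    have ht : ContDiffOn ℝ n (fun q : ℝ × ℝ => deriv (G (A q.1 q.2)) q.2) (bc.space ×ˢ univ) :=
      (ContDiffOn.of_le (hG.deriv_snd bc.uniqueDiffOn_space)
        (by exact_mod_cast le_top)).comp hΨ hmaps
    rw [Nat.cast_add, Nat.cast_one, contDiffOn_succ_iff_hasFDerivWithinAt_of_uniqueDiffOn hU]
    exact ⟨by simp, _, (hx.inv fun q hq => (hpos _ (hA q.1 hq.1 q.2) _).ne').smul
      (contDiffOn_const.sub (ht.smul contDiffOn_const)),
      fun q hq => hasFDerivWithinAt_inverse hG hA hGA hAc hpos hq⟩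

end Inverse

/-! ### The explicit Lagrangian flow map -/

/-- The exponential moments `∫₀¹ w(a)ᵏ e^{t w(a)} da`. -/
noncomputable def expMoment (w : ℝ → ℝ) (k : ℕ) (t : ℝ) : ℝ :=
  ∫ a in (0 : ℝ)..1, w a ^ k * Real.exp (t * w a)

/-- The Jacobian `e^{t w(a)} / ∫₀¹ e^{t w}`. -/
noncomputable def lagrangeJacobian (w : ℝ → ℝ) (a t : ℝ) : ℝ :=
  Real.exp (t * w a) * (expMoment w 0 t)⁻¹

/-- The common drift `-∫₀¹ w e^{t w} / ∫₀¹ e^{t w}` of the velocity gradient along trajectories. -/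
noncomputable def gradientDrift (w : ℝ → ℝ) (t : ℝ) : ℝ :=
  -(expMoment w 1 t * (expMoment w 0 t)⁻¹)

section Jacobian

variable {bc : BdryKind} {w : ℝ → ℝ}

theorem jointSmooth_pow_mul_exp (hw : ContDiffOn ℝ ∞ w bc.space) (k : ℕ) :
    JointSmooth bc.space univ fun a t => w a ^ k * Real.exp (t * w a) := by
  have h1 : JointSmooth bc.space univ fun a _ => w a := JointSmooth.of_fst hw
  have h2 : JointSmooth bc.space univ fun _ t => t := JointSmooth.of_snd contDiffOn_id
  exact JointSmooth.mul (ContDiffOn.pow h1 k) (Real.contDiff_exp.comp_contDiffOn (h2.mul h1))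

theorem contDiffOn_expMoment (hw : ContDiffOn ℝ ∞ w bc.space) (k : ℕ) :
    ContDiffOn ℝ ∞ (expMoment w k) univ :=
  (jointSmooth_pow_mul_exp hw k).primitive.contDiffOn_snd bc.one_mem_space

theorem hasDerivAt_expMoment (hw : ContDiffOn ℝ ∞ w bc.space) (k : ℕ) (t : ℝ) :
    HasDerivAt (expMoment w k) (expMoment w (k + 1) t) t := by
  refine (jointSmooth_pow_mul_exp hw k).hasDerivAt_integral (jointSmooth_pow_mul_exp hw (k + 1))
    (fun y _ t => ?_) bc.one_mem_space t
  convert! (((hasDerivAt_id t).mul_const (w y)).exp).const_mul (w y ^ k) using 1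
  simp only [id]
  ring

theorem expMoment_zero_pos (hw : ContDiffOn ℝ ∞ w bc.space) (hw0 : ∫ a in (0 : ℝ)..1, w a = 0)
    (t : ℝ) : 0 < expMoment w 0 t := by
  have := one_le_integral_exp_mul hw.continuousOn hw0 t
  simp only [expMoment, pow_zero, one_mul]
  linarith

theorem expMoment_zero_zero (w : ℝ → ℝ) : expMoment w 0 0 = 1 := by
  simp [expMoment]

theorem lagrangeJacobian_zero (w : ℝ → ℝ) (a : ℝ) : lagrangeJacobian w a 0 = 1 := by
  simp [lagrangeJacobian, expMoment_zero_zero]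

theorem gradientDrift_zero (hw0 : ∫ a in (0 : ℝ)..1, w a = 0) : gradientDrift w 0 = 0 := by
  simp [gradientDrift, expMoment, hw0]

theorem lagrangeJacobian_pos (hw : ContDiffOn ℝ ∞ w bc.space)
    (hw0 : ∫ a in (0 : ℝ)..1, w a = 0) (a t : ℝ) : 0 < lagrangeJacobian w a t :=
  mul_pos (Real.exp_pos _) (inv_pos.2 (expMoment_zero_pos hw hw0 t))

theorem contDiffOn_expMoment_inv (hw : ContDiffOn ℝ ∞ w bc.space)
    (hw0 : ∫ a in (0 : ℝ)..1, w a = 0) :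
    ContDiffOn ℝ ∞ (fun t => (expMoment w 0 t)⁻¹) univ :=
  (contDiffOn_expMoment hw 0).inv fun t _ => (expMoment_zero_pos hw hw0 t).ne'

theorem jointSmooth_lagrangeJacobian (hw : ContDiffOn ℝ ∞ w bc.space)
    (hw0 : ∫ a in (0 : ℝ)..1, w a = 0) : JointSmooth bc.space univ (lagrangeJacobian w) :=
  ((jointSmooth_pow_mul_exp hw 0).mul (JointSmooth.of_snd (contDiffOn_expMoment_inv hw hw0))).congr
    fun a _ t _ => by simp [lagrangeJacobian]

theorem contDiffOn_gradientDrift (hw : ContDiffOn ℝ ∞ w bc.space)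
    (hw0 : ∫ a in (0 : ℝ)..1, w a = 0) : ContDiffOn ℝ ∞ (gradientDrift w) univ :=
  ((contDiffOn_expMoment hw 1).mul (contDiffOn_expMoment_inv hw hw0)).neg

theorem hasDerivAt_expMoment_inv (hw : ContDiffOn ℝ ∞ w bc.space)
    (hw0 : ∫ a in (0 : ℝ)..1, w a = 0) (t : ℝ) :
    HasDerivAt (fun t => (expMoment w 0 t)⁻¹) (gradientDrift w t * (expMoment w 0 t)⁻¹) t := by
  convert! (hasDerivAt_expMoment hw 0 t).inv (expMoment_zero_pos hw hw0 t).ne' using 1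
  rw [gradientDrift]
  ring

theorem hasDerivAt_lagrangeJacobian (hw : ContDiffOn ℝ ∞ w bc.space)
    (hw0 : ∫ a in (0 : ℝ)..1, w a = 0) (a t : ℝ) :
    HasDerivAt (lagrangeJacobian w a) (lagrangeJacobian w a t * (w a + gradientDrift w t)) t := by
  convert! (((hasDerivAt_id t).mul_const (w a)).exp).mul (hasDerivAt_expMoment_inv hw hw0 t) using 1
  simp only [lagrangeJacobian, id]
  ring

theorem integral_lagrangeJacobian (hw : ContDiffOn ℝ ∞ w bc.space)
    (hw0 : ∫ a in (0 : ℝ)..1, w a = 0) (t : ℝ) :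
    ∫ a in (0 : ℝ)..1, lagrangeJacobian w a t = 1 := by
  have h : (∫ a in (0 : ℝ)..1, Real.exp (t * w a)) = expMoment w 0 t := by simp [expMoment]
  simp only [lagrangeJacobian]
  rw [intervalIntegral.integral_mul_const, h, mul_inv_cancel₀ (expMoment_zero_pos hw hw0 t).ne']

theorem intervalIntegrable_expMoment (hw : ContDiffOn ℝ ∞ w bc.space) (k : ℕ) (t : ℝ) :
    IntervalIntegrable (fun a => w a ^ k * Real.exp (t * w a)) volume 0 1 :=
  intervalIntegrable_of_continuousOn_space
    ((jointSmooth_pow_mul_exp hw k).contDiffOn_fst (mem_univ t)).continuousOn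

theorem integral_sq_mul_lagrangeJacobian (hw : ContDiffOn ℝ ∞ w bc.space) (F t : ℝ) :
    ∫ a in (0 : ℝ)..1, (w a + F) ^ 2 * lagrangeJacobian w a t =
      (expMoment w 2 t + 2 * F * expMoment w 1 t + F ^ 2 * expMoment w 0 t) *
        (expMoment w 0 t)⁻¹ := by
  have h : ∀ a, (w a + F) ^ 2 * lagrangeJacobian w a t =
      (w a ^ 2 * Real.exp (t * w a) + 2 * F * (w a ^ 1 * Real.exp (t * w a)) +
        F ^ 2 * (w a ^ 0 * Real.exp (t * w a))) * (expMoment w 0 t)⁻¹ := fun a => by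
    rw [lagrangeJacobian]
    ring
  have hi := fun k => intervalIntegrable_expMoment hw k t
  simp only [h]
  rw [intervalIntegral.integral_mul_const, intervalIntegral.integral_add
    ((hi 2).add ((hi 1).const_mul _)) ((hi 0).const_mul _), intervalIntegral.integral_add (hi 2)
    ((hi 1).const_mul _), intervalIntegral.integral_const_mul, intervalIntegral.integral_const_mul]
  rfl

/-- The drift is -(log M)', so its derivative is minus the variance of w under the probability
density `lagrangeJacobian`. This is the equation for `u_x` along trajectories. -/
theorem hasDerivAt_gradientDrift (hw : ContDiffOn ℝ ∞ w bc.space)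
    (hw0 : ∫ a in (0 : ℝ)..1, w a = 0) (t : ℝ) :
    HasDerivAt (gradientDrift w)
      (-∫ a in (0 : ℝ)..1, (w a + gradientDrift w t) ^ 2 * lagrangeJacobian w a t) t := by
  have hpos := expMoment_zero_pos hw hw0 t
  convert! ((hasDerivAt_expMoment hw 1 t).mul (hasDerivAt_expMoment_inv hw hw0 t)).neg using 1
  rw [integral_sq_mul_lagrangeJacobian hw, gradientDrift]
  field_simp
  ring

end Jacobian

/-- `G` is a family of diffeomorphisms of the spatial domain, smooth for all times, which has the
properties of the flow map of the solution with initial velocity `u₀`. -/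
structure IsFlowMap (bc : BdryKind) (u₀ : ℝ → ℝ) (G : ℝ → ℝ → ℝ) : Prop where
  smooth : JointSmooth bc.space univ G
  mem : ∀ a ∈ bc.space, ∀ t, G a t ∈ bc.space
  init : ∀ a ∈ bc.space, G a 0 = a
  init_velocity : ∀ a ∈ bc.space, deriv (G a) 0 = u₀ a
  jacobian : ∀ a ∈ bc.space, ∀ t, HasDerivWithinAt (fun a => G a t)
    (lagrangeJacobian (derivWithin u₀ bc.space) a t) bc.space a
  velocity : ∀ a ∈ bc.space, ∀ t, HasDerivWithinAt (fun a => deriv (G a) t)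
    (lagrangeJacobian (derivWithin u₀ bc.space) a t *
      (derivWithin u₀ bc.space a + gradientDrift (derivWithin u₀ bc.space) t)) bc.space a
  dirichlet : bc = .dirichlet → ∀ t, G 0 t = 0 ∧ G 1 t = 1
  periodic : bc = .periodic → ∀ a t, G (a + 1) t = G a t + 1
  acceleration : bc = .periodic → ∀ t, ∫ a in (0 : ℝ)..1,
    deriv (fun s => deriv (G a) s) t * lagrangeJacobian (derivWithin u₀ bc.space) a t = 0

/-! ### Construction of the flow map -/

theorem exists_primitive_of_contDiffOn {f : ℝ → ℝ} (hf : ContDiffOn ℝ ∞ f univ) :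
    ∃ F : ℝ → ℝ, ContDiffOn ℝ ∞ F univ ∧ F 0 = 0 ∧ ∀ t, HasDerivAt F (f t) t := by
  have h : JointSmooth BdryKind.periodic.space univ fun x _ => f x := JointSmooth.of_fst hf
  refine ⟨fun t => ∫ s in (0 : ℝ)..t, f s, h.primitive.contDiffOn_fst (mem_univ 0), by simp,
    fun t => ?_⟩
  exact hasDerivWithinAt_univ.1 (h.hasDerivWithinAt_primitive_fst (mem_univ t) 0)

theorem exists_second_primitive {f : ℝ → ℝ} (hf : ContDiffOn ℝ ∞ f univ) (v : ℝ) :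
    ∃ c c' : ℝ → ℝ, ContDiffOn ℝ ∞ c univ ∧ c 0 = 0 ∧ c' 0 = v ∧ (∀ t, HasDerivAt c (c' t) t) ∧
      ∀ t, HasDerivAt c' (f t) t := by
  obtain ⟨F, hF, hF0, hF'⟩ := exists_primitive_of_contDiffOn hf
  obtain ⟨c, hc, hc0, hc'⟩ := exists_primitive_of_contDiffOn (hF.add (contDiffOn_const (c := v)))
  exact ⟨c, _, hc, hc0, by simp [hF0], hc', fun t => (hF' t).add_const v⟩

theorem derivWithin_space_periodic {f : ℝ → ℝ} (hf : BdryKind.periodic.Holds f) (x : ℝ) :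
    derivWithin f BdryKind.periodic.space (x + 1) = derivWithin f BdryKind.periodic.space x :=
  partialX_periodic (f := fun x _ => f x) (t := 0) hf x

/-- The Jacobian fixes G up to a translation c(t). The initial position and velocity prescribe c(0)
= 0 and c'(0) = u₀(0), and the boundary setting decides the rest. -/
theorem exists_isFlowMap {bc : BdryKind} {u₀ : ℝ → ℝ} (hu₀ : ContDiffOn ℝ ∞ u₀ bc.space)
    (hbu₀ : bc.Holds u₀) : ∃ G, IsFlowMap bc u₀ G := by
  have hper : bc = .periodic → ∀ a,
      derivWithin u₀ bc.space (a + 1) = derivWithin u₀ bc.space a := by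
    rintro rfl a
    exact derivWithin_space_periodic hbu₀ a
  have hud : ∀ x ∈ bc.space, HasDerivWithinAt u₀ (derivWithin u₀ bc.space x) bc.space x :=
    fun x hx => ((hu₀.differentiableOn (by simp)) x hx).hasDerivWithinAt
  have hw : ContDiffOn ℝ ∞ (derivWithin u₀ bc.space) bc.space :=
    contDiffOn_derivWithin_space hu₀
  have hw0 := integral_derivWithin_eq_zero hu₀ hbu₀
  have hwprim : ∀ a ∈ bc.space, ∫ y in (0 : ℝ)..a, derivWithin u₀ bc.space y = u₀ a - u₀ 0 := by
    intro a ha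
    have h : JointSmooth bc.space univ fun x _ => derivWithin u₀ bc.space x := JointSmooth.of_fst hw
    have := eq_of_hasDerivWithinAt_zero bc.convex_space
      (f := fun a => (∫ y in (0 : ℝ)..a, derivWithin u₀ bc.space y) - u₀ a) (fun x hx => by
        convert! (h.hasDerivWithinAt_primitive_fst hx 0).sub (hud x hx) using 1
        rw [sub_self]) ha bc.zero_mem_space
    simp only [intervalIntegral.integral_same] at this
    linarith
  set w := derivWithin u₀ bc.space with hw_def
  set J := lagrangeJacobian w
  set J₁ : ℝ → ℝ → ℝ := fun a t => J a t * (w a + gradientDrift w t)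
  set J₂ : ℝ → ℝ → ℝ := fun a t => deriv (J₁ a) t
  have hJ : JointSmooth bc.space univ J := jointSmooth_lagrangeJacobian hw hw0
  have hJ₁ : JointSmooth bc.space univ J₁ := hJ.mul
    ((JointSmooth.of_fst hw).add (JointSmooth.of_snd (contDiffOn_gradientDrift hw hw0)))
  have hJ₂ : JointSmooth bc.space univ J₂ := hJ₁.deriv_snd bc.uniqueDiffOn_space
  -- The Jacobian-weighted mean of the acceleration without its c'' part. As the Jacobian has mass
  -- 1, taking c'' to be its negative makes the whole mean vanish in the periodic setting.
  have hforce : ContDiffOn ℝ ∞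
      (fun t => ∫ a in (0 : ℝ)..1, (∫ y in (0 : ℝ)..a, J₂ y t) * J a t) univ :=
    (hJ₂.primitive.mul hJ).primitive.contDiffOn_snd bc.one_mem_space
  obtain ⟨c, c', c'', hc, hc0, hc0', hc', hc'', hcd, hcp⟩ : ∃ c c' c'' : ℝ → ℝ,
      ContDiffOn ℝ ∞ c univ ∧ c 0 = 0 ∧ c' 0 = u₀ 0 ∧ (∀ t, HasDerivAt c (c' t) t) ∧
        (∀ t, HasDerivAt c' (c'' t) t) ∧ (bc = .dirichlet → ∀ t, c t = 0) ∧
        (bc = .periodic → ∀ t,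
          c'' t = -∫ a in (0 : ℝ)..1, (∫ y in (0 : ℝ)..a, J₂ y t) * J a t) := by
    cases bc with
    | dirichlet =>
      exact ⟨fun _ => 0, fun _ => 0, fun _ => 0, contDiffOn_const, rfl, hbu₀.1.symm,
        fun t => hasDerivAt_const _ _, fun t => hasDerivAt_const _ _, fun _ _ => rfl, by simp⟩
    | periodic =>
      obtain ⟨c, c', h1, h2, h3, h4, h5⟩ := exists_second_primitive hforce.neg (u₀ 0)
      exact ⟨c, c', _, h1, h2, h3, h4, h5, by simp, fun _ _ => rfl⟩
  set G : ℝ → ℝ → ℝ := fun a t => c t + ∫ y in (0 : ℝ)..a, J y t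
  have hG₁ : ∀ a ∈ bc.space, ∀ t, HasDerivAt (G a) (c' t + ∫ y in (0 : ℝ)..a, J₁ y t) t :=
    fun a ha t => (hc' t).add (hJ.hasDerivAt_integral hJ₁
      (fun y _ t => hasDerivAt_lagrangeJacobian hw hw0 y t) ha t)
  have hG₂ : ∀ a ∈ bc.space, ∀ t,
      HasDerivAt (fun s => deriv (G a) s) (c'' t + ∫ y in (0 : ℝ)..a, J₂ y t) t := by
    intro a ha t
    have h : (fun s => deriv (G a) s) = fun s => c' s + ∫ y in (0 : ℝ)..a, J₁ y s :=
      funext fun s => (hG₁ a ha s).deriv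
    rw [h]
    exact (hc'' t).add (hJ₁.hasDerivAt_integral hJ₂ (fun y hy t => hJ₁.hasDerivAt_snd hy t) ha t)
  have hjac : ∀ a ∈ bc.space, ∀ t, HasDerivWithinAt (fun a => G a t) (J a t) bc.space a :=
    fun a ha t => (hJ.hasDerivWithinAt_primitive_fst ha t).const_add (c t)
  have hdir : bc = .dirichlet → ∀ t, G 0 t = 0 ∧ G 1 t = 1 := fun h t => by
    simp only [G, hcd h t, intervalIntegral.integral_same, zero_add, true_and]
    exact integral_lagrangeJacobian hw hw0 t
  refine ⟨G, ⟨(JointSmooth.of_snd hc).add hJ.primitive, ?_, ?_, ?_, hjac, ?_, hdir, ?_, ?_⟩⟩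
  · intro a ha t
    cases bc with
    | periodic => exact mem_univ _
    | dirichlet =>
      have hmono : MonotoneOn (fun a => G a t) BdryKind.dirichlet.space :=
        monotoneOn_of_hasDerivWithinAt_nonneg (BdryKind.convex_space _)
          (fun x hx => (hjac x hx t).continuousWithinAt)
          (fun x hx => (hjac x (interior_subset hx) t).mono interior_subset)
          fun x _ => (lagrangeJacobian_pos hw hw0 x t).le
      have h0 := hmono (BdryKind.zero_mem_space _) ha ha.1
      have h1 := hmono ha (BdryKind.one_mem_space _) ha.2
      simp only [(hdir rfl t).1, (hdir rfl t).2] at h0 h1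
      exact ⟨h0, h1⟩
  · intro a _
    simp [G, J, hc0, lagrangeJacobian_zero]
  · intro a ha
    rw [(hG₁ a ha 0).deriv, hc0']
    simp only [J₁, J, lagrangeJacobian_zero, gradientDrift_zero hw0, one_mul, add_zero]
    rw [hwprim a ha]
    ring
  · intro a ha t
    exact ((hJ₁.hasDerivWithinAt_primitive_fst ha t).const_add (c' t)).congr_of_mem
      (fun x hx => (hG₁ x hx t).deriv) ha
  · rintro rfl a t
    have hJp : Function.Periodic (fun y => J y t) 1 := fun y => by
      simp only [J, lagrangeJacobian, hper rfl]
    have hJc : Continuous fun y => J y t := by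
      rw [← continuousOn_univ]
      exact (hJ.contDiffOn_fst (mem_univ t)).continuousOn
    have h1 := intervalIntegral.integral_add_adjacent_intervals
      (hJc.intervalIntegrable (μ := volume) 0 a) (hJc.intervalIntegrable a (a + 1))
    have h2 := hJp.intervalIntegral_add_eq a 0
    rw [zero_add, integral_lagrangeJacobian hw hw0 t] at h2
    simp only [G]
    rw [← h1, h2]
    ring
  · rintro rfl t
    have hi1 : IntervalIntegrable (fun a => c'' t * J a t) volume 0 1 :=
      (intervalIntegrable_of_continuousOn_space
        (hJ.contDiffOn_fst (mem_univ t)).continuousOn).const_mul _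
    have hi2 : IntervalIntegrable (fun a => (∫ y in (0 : ℝ)..a, J₂ y t) * J a t) volume 0 1 :=
      intervalIntegrable_of_continuousOn_space
        ((hJ₂.primitive.mul hJ).contDiffOn_fst (mem_univ t)).continuousOn
    rw [intervalIntegral.integral_congr
      (fun a _ => by rw [(hG₂ a (mem_univ a) t).deriv, add_mul]),
      intervalIntegral.integral_add hi1 hi2, intervalIntegral.integral_const_mul,
      integral_lagrangeJacobian hw hw0 t, hcp rfl t]
    ring

/-! ### The solution carried by the explicit flow map -/

theorem partialT_eq_deriv {bc : BdryKind} {T : EReal} {f : ℝ → ℝ → ℝ}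
    (hf : JointSmooth bc.space univ f) {x t : ℝ} (hx : x ∈ bc.space) (ht : t ∈ timeIvl T) :
    partialT T f x t = deriv (f x) t :=
  (hf.hasDerivAt_snd hx t).hasDerivWithinAt.derivWithin
    (uniqueDiffOn_timeIvl (pos_of_mem_timeIvl ht) t ht)

section FlowMap

variable {bc : BdryKind} {u₀ : ℝ → ℝ} {G : ℝ → ℝ → ℝ}

theorem IsFlowMap.exists_inverse (hG : IsFlowMap bc u₀ G) (hu₀ : ContDiffOn ℝ ∞ u₀ bc.space)
    (hbu₀ : bc.Holds u₀) :
    ∃ A : ℝ → ℝ → ℝ, JointSmooth bc.space univ A ∧ (∀ x ∈ bc.space, ∀ t, A x t ∈ bc.space) ∧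
      (∀ x ∈ bc.space, ∀ t, G (A x t) t = x) ∧ ∀ a ∈ bc.space, ∀ t, A (G a t) t = a := by
  have hw := contDiffOn_derivWithin_space hu₀
  have hw0 := integral_derivWithin_eq_zero hu₀ hbu₀
  set w := derivWithin u₀ bc.space with hw_def
  have hsurj : ∀ t, SurjOn (fun a => G a t) bc.space bc.space := fun t => by
    refine bc.surjOn_space (fun a ha => (hG.jacobian a ha t).continuousWithinAt)
      -- The displacement G(a,t) - a is 1-periodic, which gives the values at all integers.
      (fun h => hG.dirichlet h t) fun h n => ?_
    have hp : Function.Periodic (fun a => G a t - a) 1 := fun a => by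
      simp only [hG.periodic h a t]
      ring
    have := hp.int_mul n 0
    simp only [mul_one, zero_add, sub_zero] at this
    linarith
  -- Since w does not depend on time, the degenerate time interval τ = 0 suffices.
  obtain ⟨W, hW0, hW⟩ := exists_bound_of_continuousOn (bc := bc) (τ := 0) (f := fun x _ => w x)
    (JointSmooth.of_fst hw).continuousOn (by
      rintro rfl _ _ x
      exact derivWithin_space_periodic hbu₀ x)
  set A : ℝ → ℝ → ℝ := fun x t => Function.invFunOn (fun a => G a t) bc.space x
  have hA : ∀ x ∈ bc.space, ∀ t, A x t ∈ bc.space := fun x hx t =>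
    Function.invFunOn_mem (hsurj t hx)
  have hGA : ∀ x ∈ bc.space, ∀ t, G (A x t) t = x := fun x hx t =>
    Function.invFunOn_eq (hsurj t hx)
  have hM : Continuous (expMoment w 0) := by
    rw [← continuousOn_univ]
    exact (contDiffOn_expMoment hw 0).continuousOn
  have hMpos := expMoment_zero_pos hw hw0
  -- A bound below for the Jacobian, uniform in the label, from tw(a) ≥ -|t|W.
  set m : ℝ → ℝ := fun t => Real.exp (-(|t| * W)) * (expMoment w 0 t)⁻¹
  have hm : Continuous m :=
    Continuous.mul (by fun_prop) (hM.inv₀ fun t => (hMpos t).ne')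
  have hm0 : ∀ t, 0 < m t := fun t => mul_pos (Real.exp_pos _) (inv_pos.2 (hMpos t))
  have hlow : ∀ a ∈ bc.space, ∀ t, m t ≤ lagrangeJacobian w a t := fun a ha t => by
    refine mul_le_mul_of_nonneg_right (Real.exp_le_exp.2 ?_) (inv_nonneg.2 (hMpos t).le)
    refine (neg_le_neg ?_).trans (neg_abs_le _)
    rw [abs_mul]
    exact mul_le_mul_of_nonneg_left (hW a ha 0 ⟨le_rfl, le_rfl⟩) (abs_nonneg _)
  refine ⟨A, hG.smooth.inverse hA hGA hm hm0 fun a ha t => ?_, hA, hGA, fun a ha t => ?_⟩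
  · rw [(hG.jacobian a ha t).derivWithin (bc.uniqueDiffOn_space a ha)]
    exact hlow a ha t
  · have hGa := hG.mem a ha t
    have := mul_abs_sub_le_of_le_derivWithin bc.convex_space (fun x hx => hG.jacobian x hx t)
      (fun x hx => hlow x hx t) (hA _ hGa t) ha
    simp only [hGA _ hGa t, sub_self, abs_zero] at this
    have h1 := abs_nonpos_iff.1 (nonpos_of_mul_nonpos_right this (hm0 t))
    linarith

/-- Substitution x = G(a,t). The image of [0,1] is [0,1] itself or, in the periodic setting, another
full period. -/
theorem IsFlowMap.integral_comp_mul_jacobian (hG : IsFlowMap bc u₀ G)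
    (hu₀ : ContDiffOn ℝ ∞ u₀ bc.space) (hbu₀ : bc.Holds u₀) {g : ℝ → ℝ}
    (hg : ContinuousOn g bc.space) (hp : bc = .periodic → ∀ x, g (x + 1) = g x) (t : ℝ) :
    ∫ x in (0 : ℝ)..1, g x =
      ∫ a in (0 : ℝ)..1, g (G a t) * lagrangeJacobian (derivWithin u₀ bc.space) a t := by
  have hJ : JointSmooth bc.space univ (lagrangeJacobian (derivWithin u₀ bc.space)) :=
    jointSmooth_lagrangeJacobian (contDiffOn_derivWithin_space hu₀)
      (integral_derivWithin_eq_zero hu₀ hbu₀)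
  rw [integral_comp_mul_deriv_space (fun a ha => hG.jacobian a ha t)
    (hJ.contDiffOn_fst (mem_univ t)).continuousOn (fun a ha => hG.mem a ha t) hg]
  cases bc with
  | dirichlet => rw [(hG.dirichlet rfl t).1, (hG.dirichlet rfl t).2]
  | periodic =>
    have h1 := hG.periodic rfl 0 t
    rw [zero_add] at h1
    have hper : Function.Periodic g 1 := hp rfl
    rw [h1, hper.intervalIntegral_add_eq _ 0, zero_add]

/-- The Eulerian fields obtained from the explicit flow map solve the system. -/
theorem IsFlowMap.exists_solution {b₀ : ℝ → ℝ} (hG : IsFlowMap bc u₀ G)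
    (hu₀ : ContDiffOn ℝ ∞ u₀ bc.space) (hbu₀ : bc.Holds u₀)
    (hb₀ : ContDiffOn ℝ ∞ b₀ bc.space) (hbb₀ : bc.Holds b₀) :
    ∃ u b p : ℝ → ℝ → ℝ, (∀ T : EReal, IsSolution bc 0 0 T u₀ b₀ u b p) ∧
      (bc = .periodic → ∀ t, p 0 t = p 1 t) := by
  have hw := contDiffOn_derivWithin_space hu₀
  have hw0 := integral_derivWithin_eq_zero hu₀ hbu₀
  obtain ⟨A, hA, hAm, hGA, hAG⟩ := hG.exists_inverse hu₀ hbu₀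
  have hX := bc.uniqueDiffOn_space
  set w := derivWithin u₀ bc.space with hw_def
  set u : ℝ → ℝ → ℝ := fun x t => deriv (G (A x t)) t
  set b : ℝ → ℝ → ℝ := fun x t => b₀ (A x t)
  have hu : JointSmooth bc.space univ u :=
    (hG.smooth.deriv_snd hX).comp_fst hA fun x hx t _ => hAm x hx t
  have hb : JointSmooth bc.space univ b :=
    JointSmooth.comp_fst (JointSmooth.of_fst hb₀) hA fun x hx t _ => hAm x hx t
  have hux : JointSmooth bc.space univ (partialX bc u) := hu.partial_fst hX uniqueDiffOn_univ
  have hut : JointSmooth bc.space univ fun x t => deriv (u x) t := hu.deriv_snd hX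
  set acc : ℝ → ℝ → ℝ := fun x t => deriv (u x) t + u x t * partialX bc u x t
  have hacc : JointSmooth bc.space univ acc := hut.add (hu.mul hux)
  -- The momentum equation solved for the pressure, with `acc` the acceleration u_t + uu_x.
  set p : ℝ → ℝ → ℝ := fun x t => b x t * b x t * (1 / 2) - ∫ y in (0 : ℝ)..x, acc y t
  have hp : JointSmooth bc.space univ p :=
    ((hb.mul hb).mul (JointSmooth.const _)).sub hacc.primitive
  have huG : ∀ a ∈ bc.space, ∀ t, u (G a t) t = deriv (G a) t := fun a ha t => by
    simp only [u, hAG a ha t]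
  have hGd : ∀ a ∈ bc.space, ∀ t, HasDerivAt (G a) (u (G a t) t) t := fun a ha t => by
    rw [huG a ha t]
    exact hG.smooth.hasDerivAt_snd ha t
  have huxG : ∀ a ∈ bc.space, ∀ t, partialX bc u (G a t) t = w a + gradientDrift w t := by
    intro a ha t
    have h1 := (hu.hasDerivWithinAt_fst (hG.mem a ha t) (mem_univ t)).comp a
      (hG.jacobian a ha t) fun x hx => hG.mem x hx t
    -- Differentiate u(G(a,t),t) = G_t(a,t) in a and cancel the positive Jacobian.
    have h2 := (hX a ha).eq_deriv _ h1
      ((hG.velocity a ha t).congr_of_mem (fun x hx => huG x hx t) ha)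
    have hpos := lagrangeJacobian_pos hw hw0 a t
    rw [mul_comm] at h2
    exact mul_left_cancel₀ hpos.ne' h2
  have haccG : ∀ a ∈ bc.space, ∀ t, acc (G a t) t = deriv (fun s => deriv (G a) s) t := by
    intro a ha t
    have h1 := hu.hasDerivAt_curve hX (fun s => hG.mem a ha s) (hGd a ha t)
    have h2 : (fun s => u (G a s) s) = fun s => deriv (G a) s := funext fun s => huG a ha s
    rw [h2] at h1
    exact h1.deriv.symm
  have hAper : bc = .periodic → ∀ x t, A (x + 1) t = A x t + 1 := by
    rintro rfl x t
    have h := hG.periodic rfl (A x t) t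
    rw [hGA x (mem_univ _) t] at h
    rw [← h, hAG _ (mem_univ _)]
  have huper : bc = .periodic → ∀ x t, u (x + 1) t = u x t := fun h x t => by
    have h1 : G (A x t + 1) = fun s => G (A x t) s + 1 := funext fun s => hG.periodic h _ s
    simp only [u, hAper h x t, h1, deriv_add_const]
  have huxper : bc = .periodic → ∀ x t, partialX bc u (x + 1) t = partialX bc u x t := by
    rintro rfl x t
    exact partialX_periodic (fun x => huper rfl x t) x
  have haccper : bc = .periodic → ∀ x t, acc (x + 1) t = acc x t := fun h x t => by
    have h1 : u (x + 1) = u x := funext fun s => huper h x s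
    simp only [acc, h1, huxper h x t]
  have hbper : bc = .periodic → ∀ x t, b (x + 1) t = b x t := by
    rintro rfl x t
    simp only [b, hAper rfl x t]
    exact hbb₀ _
  have hA0 : bc = .dirichlet → ∀ t, A 0 t = 0 ∧ A 1 t = 1 := fun h t => by
    have h0 := hAG 0 bc.zero_mem_space t
    have h1 := hAG 1 bc.one_mem_space t
    rw [(hG.dirichlet h t).1] at h0
    rw [(hG.dirichlet h t).2] at h1
    exact ⟨h0, h1⟩
  have hinit : ∀ x ∈ bc.space, A x 0 = x := fun x hx => by
    have := hAG x hx 0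
    rwa [hG.init x hx] at this
  refine ⟨u, b, p, fun T => ?_, fun h t => ?_⟩
  · have hsub : timeIvl T ⊆ univ := subset_univ _
    refine ⟨hu.mono subset_rfl hsub, hb.mono subset_rfl hsub, hp.mono subset_rfl hsub,
      fun t _ => ?_, fun t _ => ?_, fun x hx => ?_, fun x hx => ?_, fun x hx t ht => ?_,
      fun x hx t ht => ?_, fun x hx t ht => ?_⟩
    · cases bc with
      | dirichlet =>
        have h0 : G 0 = fun _ => 0 := funext fun s => (hG.dirichlet rfl s).1
        have h1 : G 1 = fun _ => 1 := funext fun s => (hG.dirichlet rfl s).2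
        constructor
        · simp only [u, (hA0 rfl t).1, h0, deriv_const]
        · simp only [u, (hA0 rfl t).2, h1, deriv_const]
      | periodic => exact fun x => huper rfl x t
    · cases bc with
      | dirichlet =>
        constructor
        · simp only [b, (hA0 rfl t).1, hbb₀.1]
        · simp only [b, (hA0 rfl t).2, hbb₀.2]
      | periodic => exact fun x => hbper rfl x t
    · simp only [u, hinit x hx, hG.init_velocity x hx]
    · simp only [b, hinit x hx]
    · rw [partialT_eq_deriv hux hx ht]
      set a := A x t
      have ha : a ∈ bc.space := hAm x hx t
      have hx' : G a t = x := hGA x hx t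
      have h1 := hux.hasDerivAt_curve hX (fun s => hG.mem a ha s) (hGd a ha t)
      have h2 : (fun s => partialX bc u (G a s) s) = fun s => w a + gradientDrift w s :=
        funext fun s => huxG a ha s
      rw [h2] at h1
      -- On the trajectory through (x,t) the equation becomes the equation for the drift; the
      -- nonlocal integral is moved to labels to match.
      have h3 := h1.unique ((hasDerivAt_gradientDrift hw hw0 t).const_add (w a))
      have h4 := hG.integral_comp_mul_jacobian hu₀ hbu₀ (g := fun y => partialX bc u y t ^ 2)
        ((hux.contDiffOn_fst (mem_univ t)).continuousOn.pow 2)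
        (fun h y => by simp only [huxper h y t]) t
      have h5 : ∫ a in (0 : ℝ)..1, partialX bc u (G a t) t ^ 2 * lagrangeJacobian w a t =
          ∫ a in (0 : ℝ)..1, (w a + gradientDrift w t) ^ 2 * lagrangeJacobian w a t := by
        refine intervalIntegral.integral_congr fun a ha => ?_
        rw [uIcc_of_le zero_le_one] at ha
        simp only [huxG a (bc.Icc_subset_space ha) t]
      rw [hx'] at h3
      simp only [nonlocalTerm, zero_mul, sub_zero, zero_add, zero_sub, one_mul, add_zero,
        h4.trans h5]
      exact h3
    · rw [partialT_eq_deriv hb hx ht]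
      set a := A x t
      have ha : a ∈ bc.space := hAm x hx t
      have hx' : G a t = x := hGA x hx t
      have h1 := hb.hasDerivAt_curve hX (fun s => hG.mem a ha s) (hGd a ha t)
      have h2 : (fun s => b (G a s) s) = fun _ => b₀ a := funext fun s => by
        simp only [b, hAG a ha s]
      rw [h2] at h1
      have h3 := h1.unique (hasDerivAt_const t (b₀ a))
      rw [hx'] at h3
      simp only [zero_mul]
      exact h3
    · rw [partialT_eq_deriv hu hx ht]
      have hb1 := hb.hasDerivWithinAt_fst hx (mem_univ t)
      have h1 := ((hb1.mul hb1).mul_const (1 / 2)).sub (hacc.hasDerivWithinAt_primitive_fst hx t)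
      have h2 : partialX bc p x t = _ := h1.derivWithin (hX x hx)
      rw [h2]
      simp only [acc, partialX]
      ring
  · have h1 := hG.integral_comp_mul_jacobian hu₀ hbu₀ (g := fun y => acc y t)
      (hacc.contDiffOn_fst (mem_univ t)).continuousOn (fun h y => haccper h y t) t
    have h2 : ∫ a in (0 : ℝ)..1, acc (G a t) t * lagrangeJacobian w a t =
        ∫ a in (0 : ℝ)..1, deriv (fun s => deriv (G a) s) t * lagrangeJacobian w a t := by
      refine intervalIntegral.integral_congr fun a ha => ?_
      rw [uIcc_of_le zero_le_one] at ha
      simp only [haccG a (bc.Icc_subset_space ha) t]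
    have h3 : b 1 t = b 0 t := by
      have := hbper h 0 t
      rwa [zero_add] at this
    simp only [p, intervalIntegral.integral_same, h1.trans (h2.trans (hG.acceleration h t)), h3]

end FlowMap

/-! ### The theorem -/

theorem theorem8p1 (bc : BdryKind) (u₀ b₀ : ℝ → ℝ)
    (hu₀ : ContDiffOn ℝ ∞ u₀ bc.space) (hb₀ : ContDiffOn ℝ ∞ b₀ bc.space)
    (hbu₀ : bc.Holds u₀) (hbb₀ : bc.Holds b₀) :
    -- a global smooth solution exists, and solutions on shorter time intervals are part of it
    (∃ u b p : ℝ → ℝ → ℝ, IsSolution bc 0 0 ⊤ u₀ b₀ u b p ∧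
      (bc = BdryKind.periodic → ∀ t, 0 ≤ t → p 0 t = p 1 t) ∧
      ∀ T : EReal, 0 < T → ∀ v c q : ℝ → ℝ → ℝ, IsSolution bc 0 0 T u₀ b₀ v c q →
        (bc = BdryKind.periodic → ∀ t ∈ timeIvl T, q 0 t = q 1 t) →
        ∀ x ∈ bc.space, ∀ t ∈ timeIvl T, v x t = u x t ∧ c x t = b x t) ∧
    -- the formulas along the trajectories of any solution
    (∀ T : EReal, 0 < T → ∀ u b p : ℝ → ℝ → ℝ, IsSolution bc 0 0 T u₀ b₀ u b p →
      (∃ γ : ℝ → ℝ → ℝ, IsFlow bc T u γ) ∧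
      ∀ γ : ℝ → ℝ → ℝ, IsFlow bc T u γ → ∀ α ∈ bc.space, ∀ t ∈ timeIvl T,
        HasDerivWithinAt (fun a => γ a t)
          (Real.exp (∫ s in (0 : ℝ)..t, partialX bc u (γ α s) s)) bc.space α ∧
        Real.exp (∫ s in (0 : ℝ)..t, partialX bc u (γ α s) s)
          = Real.exp (t * derivWithin u₀ bc.space α)
            * (∫ a in (0 : ℝ)..1, Real.exp (t * derivWithin u₀ bc.space a))⁻¹ ∧
        b (γ α t) t = b₀ α ∧
        0 ≤ derivWithin u₀ bc.space α - partialX bc u (γ α t) t ∧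
        derivWithin u₀ bc.space α - partialX bc u (γ α t) t
          ≤ ∫ a in (0 : ℝ)..1,
              derivWithin u₀ bc.space a * Real.exp (t * derivWithin u₀ bc.space a)) := by
  constructor
  · obtain ⟨G, hG⟩ := exists_isFlowMap hu₀ hbu₀
    obtain ⟨u, b, p, hs, hp⟩ := hG.exists_solution hu₀ hbu₀ hb₀ hbb₀
    -- The constructed fields solve the system on every [0,T), so the comparison takes place on the
    -- interval of the other solution.
    exact ⟨u, b, p, hs ⊤, fun h t _ => hp h t, fun T _ v c q hs' hq x hx t ht =>
      hs'.unique (hs T) hu₀ hbu₀ hq (fun h t _ => hp h t) hx ht⟩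
  · intro T hT u b p hs
    refine ⟨exists_isFlow hs.smooth_u hs.bdry_u hT, fun γ hγ α hα t ht => ?_⟩
    obtain ⟨h1, h2, h3⟩ := hs.flow_formulas hu₀ hbu₀ hγ hα ht
    exact ⟨hγ.hasDerivWithinAt_exp_integral hs.smooth_u hs.bdry_u hα ht, h1,
      hs.magnetic_flow hγ hα ht, h2, h3⟩
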